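/- Let $(\mathcal X,d_0)$ be a compact metric space with $d_0\le 1$, equipped with its Borel $\sigma$-algebra. Let $\mathfrak N$ be the space of finite point measures $\xi=\sum_{i=1}^m\delta_{x_i}$ ($m\ge 0$, $x_i\in\mathcal X$) on $\mathcal X$, with the vague topology (which here is the weak topology) and the $\sigma$-algebra generated by it; write $|\xi|=m$ for the total number of points. Let $\mathfrak P(\mathfrak N)$ be the set of probability measures on $\mathfrak N$. A point process is a random element of $\mathfrak N$, and $\mathscr L$ denotes the law of a random element. For $\xi=\sum_{i=1}^m\delta_{x_i}$ and $\eta=\sum_{j=1}^n\delta_{y_j}$ with $n\ge\max(m,1)$ put $$\bar d_1(\xi,\eta)=\bar d_1(\eta,\xi):=\frac1n\Bigl(\min_{\pi\in\Pi_n}\sum_{i=1}^m d_0(x_i,y_{\pi(i)})+(n-m)\Bigr),\qquad \bar d_1(0,0):=0,$$ where $\Pi_n$ is the set of permutations of $\{1,\dots,n\}$. Put $d_1(\xi,\eta):=\frac1n\min_{\pi\in\Pi_n}\sum_{i=1}^n d_0(x_i,y_{\pi(i)})$ if $m=n\ge1$, $d_1(\xi,\eta):=1$ if $m\ne n$, and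 $d_1(0,0):=0$. For $P,Q\in\mathfrak P(\mathfrak N)$ define $$\bar d_2(P,Q):=\sup_f\Bigl|\int f\,dP-\int f\,dQ\Bigr|,$$ the supremum being over all $f:\mathfrak N\to[0,1]$ with $|f(\xi)-f(\eta)|\le\bar d_1(\xi,\eta)$ for all $\xi,\eta\in\mathfrak N$, and define $d_2(P,Q)$ in the same way with $d_1$ in place of $\bar d_1$. On $\mathbb Z_+$ put $d_R(m,n):=|m-n|/\max(m,n)$ if $\max(m,n)>0$ and $d_R(0,0):=0$, and for probability measures $\mu,\nu$ on $\mathbb Z_+$ put $d_{RW}(\mu,\nu):=\min_{M\sim\mu,\,N\sim\nu}\mathbb E\,d_R(M,N)$, the minimum being over all couplings of $\mu$ and $\nu$. **Proposition.** The map $\bar d_2$ is a metric on $\mathfrak P(\mathfrak N)$, and the minimum that defines $d_{RW}$ is attained. Moreover: 1. For all $P,Q\in\mathfrak P(\mathfrak N)$, $\bar d_2(P,Q)=\min_{\Xi\sim P,\ \mathrm H\sim Q}\mathbb E\,\bar d_1(\Xi,\mathrm H)$, where the minimum is over all couplings of $P$ and $Q$ and is attained. 2. For any point processes $\Xi$ and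 $\mathrm H$ on $\mathcal X$, $$d_{RW}\bigl(\mathscr L(|\Xi|),\mathscr L(|\mathrm H|)\bigr)\le\bar d_2\bigl(\mathscr L(\Xi),\mathscr L(\mathrm H)\bigr)\le d_2\bigl(\mathscr L(\Xi),\mathscr L(\mathrm H)\bigr).$$ 3. $\bar d_2$ metrizes the weak topology on $\mathfrak P(\mathfrak N)$. Consequently, for point processes $\Xi,\Xi_1,\Xi_2,\dots$ on $\mathcal X$, $\Xi_n$ converges in distribution to $\Xi$ if and only if $\bar d_2(\mathscr L(\Xi_n),\mathscr L(\Xi))\to0$. -/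

import Mathlib

open MeasureTheory Filter Topology

noncomputable section

/-- The space of finite point measures on `X`: the finite measures of the form `∑ i, δ_{x i}`
with finitely many (possibly repeated, possibly no) points `x i` of `X`. -/
def PointMeasure (X : Type*) [MeasurableSpace X] : Type _ :=
  {ξ : FiniteMeasure X // ∃ (n : ℕ) (x : Fin n → X),
    (ξ : Measure X) = ∑ i, Measure.dirac (x i)}

namespace PointMeasure

section Basic

variable {X : Type*} [MeasurableSpace X]

/-- The underlying measure of a finite point measure. -/
def toMeasure (ξ : PointMeasure X) : Measure X := (ξ.1 : Measure X)

/-- The point measure `∑ i, δ_{x i}`. -/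
def ofPoints {n : ℕ} (x : Fin n → X) : PointMeasure X :=
  ⟨⟨∑ i, Measure.dirac (x i), inferInstance⟩, n, x, rfl⟩

/-- The total number `|ξ|` of points of `ξ`. -/
def card (ξ : PointMeasure X) : ℕ := ξ.2.choose

/-- An enumeration `x₁, …, x_{|ξ|}` of the points of `ξ`, so that `ξ = ∑ i, δ_{x i}`. -/
def points (ξ : PointMeasure X) : Fin ξ.card → X := ξ.2.choose_spec.choose

theorem toMeasure_eq_sum (ξ : PointMeasure X) :
    ξ.toMeasure = ∑ i, Measure.dirac (ξ.points i) :=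
  ξ.2.choose_spec.choose_spec

theorem toMeasure_ofPoints {n : ℕ} (x : Fin n → X) :
    (ofPoints x).toMeasure = ∑ i, Measure.dirac (x i) := rfl

theorem toMeasure_univ (ξ : PointMeasure X) : ξ.toMeasure Set.univ = ξ.card := by
  rw [toMeasure_eq_sum]; simp

/-- The vague topology, tested by continuous functions on `X`. On a compact space these all have
compact support and are bounded, so that it is the weak topology of finite measures. -/
instance [TopologicalSpace X] [OpensMeasurableSpace X] : TopologicalSpace (PointMeasure X) :=
  instTopologicalSpaceSubtype

/-- The σ-algebra generated by the vague topology. -/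
instance [TopologicalSpace X] [OpensMeasurableSpace X] : MeasurableSpace (PointMeasure X) :=
  borel (PointMeasure X)

instance [TopologicalSpace X] [OpensMeasurableSpace X] : BorelSpace (PointMeasure X) := ⟨rfl⟩

end Basic

section Metrics

variable {X : Type*} [MetricSpace X]

/-- `min_{π ∈ Π_n} ∑_{i ≤ m} d₀(x_i, y_{π(i)})` for points `x₁, …, x_m` and `y₁, …, y_n` with
`m ≤ n`. -/
def matchCost {m n : ℕ} (h : m ≤ n) (x : Fin m → X) (y : Fin n → X) : ℝ :=
  Finset.univ.inf' Finset.univ_nonempty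
    fun π : Equiv.Perm (Fin n) => ∑ i : Fin m, dist (x i) (y (π (Fin.castLE h i)))

/-- The formula for `d̄₁` in terms of points; it is `0 / 0 = 0` for `m = n = 0`. -/
def dbar1Points {m n : ℕ} (x : Fin m → X) (y : Fin n → X) : ℝ :=
  if h : m ≤ n then (matchCost h x y + ((n : ℝ) - m)) / n
  else (matchCost (le_of_not_ge h) y x + ((m : ℝ) - n)) / m

/-- The formula for `d₁` in terms of points; it is `0 / 0 = 0` for `m = n = 0`. -/
def d1Points {m n : ℕ} (x : Fin m → X) (y : Fin n → X) : ℝ :=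
  if h : m = n then matchCost h.le x y / n else 1

theorem matchCost_perm {m n : ℕ} (h : m ≤ n) (x : Fin m → X) (y : Fin n → X)
    (σ : Equiv.Perm (Fin m)) (τ : Equiv.Perm (Fin n)) :
    matchCost h (x ∘ σ) (y ∘ τ) = matchCost h x y := by
  have key : ∀ (x : Fin m → X) (y : Fin n → X) (σ : Equiv.Perm (Fin m))
      (τ : Equiv.Perm (Fin n)), matchCost h x y ≤ matchCost h (x ∘ σ) (y ∘ τ) := by
    intro x y σ τ
    refine Finset.le_inf' _ _ fun π _ => ?_
    obtain ⟨ρ, hρ⟩ : ∃ ρ : Equiv.Perm (Fin n),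
        ∀ i : Fin m, ρ (Fin.castLE h i) = Fin.castLE h (σ.symm i) := by
      let f : Fin m ≃ {j : Fin n // (j : ℕ) < m} :=
        { toFun := fun i => ⟨Fin.castLE h i, i.2⟩
          invFun := fun j => ⟨j.1, j.2⟩
          left_inv := fun i => rfl
          right_inv := fun j => rfl }
      refine ⟨Equiv.Perm.extendDomain σ.symm f, fun i => ?_⟩
      exact Equiv.Perm.extendDomain_apply_image σ.symm f i
    refine (Finset.inf'_le _ (Finset.mem_univ (τ * π * ρ))).trans (le_of_eq ?_)
    rw [← Equiv.sum_comp σ]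
    simp [hρ]
  refine le_antisymm ?_ (key x y σ τ)
  have := key (x ∘ σ) (y ∘ τ) σ.symm τ.symm
  simpa [Function.comp_assoc] using this

variable [MeasurableSpace X] [BorelSpace X]

/-- The points of a point measure are determined up to their order. -/
theorem eq_perm_of_sum_dirac_eq {m n : ℕ} {x : Fin m → X} {y : Fin n → X}
    (h : ∑ i, Measure.dirac (x i) = ∑ i, Measure.dirac (y i)) :
    ∃ (e : m = n) (σ : Equiv.Perm (Fin m)), x = (y ∘ Fin.cast e) ∘ σ := by
  classical
  have hmn : m = n := by
    have := congrArg (fun μ : Measure X => μ Set.univ) h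
    simpa using this
  subst hmn
  refine ⟨rfl, ?_⟩
  have hc : ∀ a, Fintype.card {i // x i = a} = Fintype.card {i // y i = a} := by
    intro a
    have := congrArg (fun μ : Measure X => μ {a}) h
    simp only [Measure.coe_finsetSum, Finset.sum_apply,
      Measure.dirac_apply' _ (measurableSet_singleton a), Set.indicator_apply,
      Set.mem_singleton_iff, Pi.one_apply, Finset.sum_boole] at this
    rw [Fintype.card_subtype, Fintype.card_subtype]
    exact_mod_cast this
  let σ : Fin m ≃ Fin m := (Equiv.sigmaFiberEquiv x).symm.trans
    ((Equiv.sigmaCongrRight fun a => Fintype.equivOfCardEq (hc a)).trans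
      (Equiv.sigmaFiberEquiv y))
  refine ⟨σ, funext fun i => ?_⟩
  exact ((Fintype.equivOfCardEq (hc (x i))) ⟨i, rfl⟩).2.symm

/-- The metric `d̄₁` on finite point measures. -/
def dbar1 (ξ η : PointMeasure X) : ℝ := dbar1Points ξ.points η.points

/-- The metric `d₁` on finite point measures. -/
def d1 (ξ η : PointMeasure X) : ℝ := d1Points ξ.points η.points

theorem card_ofPoints {n : ℕ} (x : Fin n → X) : (ofPoints x).card = n :=
  (eq_perm_of_sum_dirac_eq ((ofPoints x).toMeasure_eq_sum.symm.trans
    (toMeasure_ofPoints x))).1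

/-- The value of `d̄₁` does not depend on the enumerations. -/
theorem dbar1_ofPoints {m n : ℕ} (x : Fin m → X) (y : Fin n → X) :
    dbar1 (ofPoints x) (ofPoints y) = dbar1Points x y := by
  obtain ⟨e, σ, hσ⟩ := eq_perm_of_sum_dirac_eq
    ((ofPoints x).toMeasure_eq_sum.symm.trans (toMeasure_ofPoints x))
  obtain ⟨e', τ, hτ⟩ := eq_perm_of_sum_dirac_eq
    ((ofPoints y).toMeasure_eq_sum.symm.trans (toMeasure_ofPoints y))
  unfold dbar1
  rw [hσ, hτ]
  clear hσ hτ
  generalize (ofPoints x).card = p at *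
  generalize (ofPoints y).card = q at *
  subst e e'
  simp only [dbar1Points, matchCost_perm]
  rfl

/-- The value of `d₁` does not depend on the enumerations. -/
theorem d1_ofPoints {m n : ℕ} (x : Fin m → X) (y : Fin n → X) :
    d1 (ofPoints x) (ofPoints y) = d1Points x y := by
  obtain ⟨e, σ, hσ⟩ := eq_perm_of_sum_dirac_eq
    ((ofPoints x).toMeasure_eq_sum.symm.trans (toMeasure_ofPoints x))
  obtain ⟨e', τ, hτ⟩ := eq_perm_of_sum_dirac_eq
    ((ofPoints y).toMeasure_eq_sum.symm.trans (toMeasure_ofPoints y))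
  unfold d1
  rw [hσ, hτ]
  clear hσ hτ
  generalize (ofPoints x).card = p at *
  generalize (ofPoints y).card = q at *
  subst e e'
  simp only [d1Points, matchCost_perm]
  rfl

/-- `d̄₂(P, Q) = sup_f |∫ f dP - ∫ f dQ|` over all `f : 𝔑 → [0,1]` that are 1-Lipschitz with
respect to `d̄₁`. -/
def dbar2 (P Q : Measure (PointMeasure X)) : ℝ :=
  sSup {r | ∃ f : PointMeasure X → ℝ, (∀ ξ, f ξ ∈ Set.Icc (0 : ℝ) 1) ∧
    (∀ ξ η, |f ξ - f η| ≤ dbar1 ξ η) ∧ r = |∫ ξ, f ξ ∂P - ∫ ξ, f ξ ∂Q|}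

/-- `d₂(P, Q) = sup_f |∫ f dP - ∫ f dQ|` over all `f : 𝔑 → [0,1]` that are 1-Lipschitz with
respect to `d₁`. -/
def d2 (P Q : Measure (PointMeasure X)) : ℝ :=
  sSup {r | ∃ f : PointMeasure X → ℝ, (∀ ξ, f ξ ∈ Set.Icc (0 : ℝ) 1) ∧
    (∀ ξ η, |f ξ - f η| ≤ d1 ξ η) ∧ r = |∫ ξ, f ξ ∂P - ∫ ξ, f ξ ∂Q|}

end Metrics

end PointMeasure

/-- The expected costs `𝔼 c(U, V)` over all couplings of `μ` and `ν`, that is, over all joint laws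
`γ` of pairs `(U, V)` with `U ∼ μ` and `V ∼ ν`. -/
def couplingCosts {S : Type*} [MeasurableSpace S] (c : S → S → ℝ) (μ ν : Measure S) : Set ℝ :=
  {r | ∃ γ : Measure (S × S), γ.map Prod.fst = μ ∧ γ.map Prod.snd = ν ∧
    r = ∫ z, c z.1 z.2 ∂γ}

/-- The relative difference metric `d_R` on the nonnegative integers; `d_R(0, 0) = 0 / 0 = 0`. -/
def relDiff (m n : ℕ) : ℝ := |(m : ℝ) - n| / max (m : ℝ) n

/-- `d_RW(μ, ν)`, the least expected relative difference over all couplings. -/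
def dRW (μ ν : Measure ℕ) : ℝ := sInf (couplingCosts relDiff μ ν)

end

/-! The proof combines optimal transport on locally compact second countable spaces with a study of
the space of point measures.

Duality: the least integral p(h) of a sum φ ⊕ ψ ≥ h is a sublinear functional of h. Hahn–Banach
yields a linear L ≤ p with L(-c) = p(-c). Domination by p makes L positive and fixes its marginals,
which give tightness, so the Riesz theorem turns L into a coupling; it is optimal for the cost c
(`exists_coupling_integral_le`). If c is a metric bounded by 1, an infimal convolution replaces a
dual pair (φ, ψ) by a single 1-Lipschitz function with values in [0,1]
(`isLeast_couplingCosts_lipschitzDual`). Markov's inequality and the layer-cake formula compare the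
resulting distance with the Lévy–Prokhorov distance in both directions, hence it metrizes weak
convergence.

Point measures: up to normalization, `dbar1` is the cost of an optimal partial matching in which
unmatched points cost 1. Composing matchings gives the triangle inequality (`dbar1Points_triangle`).
The measures with n points form an open compact set, the image of X^n; this gives local compactness
and lets compactness identify the `dbar1` topology with the vague one (`isOpen_iff_dbar1`). The
general theory then applies to `dbar1`. The comparison inequalities follow from `relDiff` ≤ `dbar1`
≤ `d1`. -/

open scoped BoundedContinuousFunction CompactlySupported

noncomputable section

/-! ### Kantorovich duality for bounded continuous costs -/

/-- A σ-compact locally compact space carries compactly supported cutoff functions increasing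
to the constant `1`. -/
theorem exists_cutoff_seq (S : Type*) [TopologicalSpace S] [T2Space S] [LocallyCompactSpace S]
    [SigmaCompactSpace S] :
    ∃ χ : ℕ → C_c(S, ℝ), (∀ n x, 0 ≤ χ n x) ∧ (∀ n x, χ n x ≤ 1) ∧
      ∀ x, Tendsto (fun n => χ n x) atTop (𝓝 1) := by
  let K := CompactExhaustion.choice S
  have h : ∀ n, ∃ f : C(S, ℝ), Set.EqOn f 1 (K n) ∧ Set.EqOn f 0 ∅ ∧ HasCompactSupport f ∧
      ∀ x, f x ∈ Set.Icc (0 : ℝ) 1 := fun n =>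
    exists_continuous_one_zero_of_isCompact (K.isCompact n) isClosed_empty (Set.disjoint_empty _)
  choose f h1 _ hc h01 using h
  refine ⟨fun n => ⟨f n, hc n⟩, fun n x => (h01 n x).1, fun n x => (h01 n x).2, fun x => ?_⟩
  refine tendsto_const_nhds.congr' ?_
  filter_upwards [eventually_ge_atTop (K.find x)] with n hn
  exact (h1 n (K.subset hn (K.mem_find x))).symm

/-- A positive linear functional on bounded continuous functions that is tight along a sequence of
compactly supported cutoffs is integration against a finite measure. -/
theorem exists_measure_integral_eq {T : Type*} [TopologicalSpace T] [T2Space T]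
    [LocallyCompactSpace T] [MeasurableSpace T] [BorelSpace T]
    (L : (T →ᵇ ℝ) →ₗ[ℝ] ℝ) (hL : ∀ h : T →ᵇ ℝ, (∀ x, 0 ≤ h x) → 0 ≤ L h)
    (θ : ℕ → C_c(T, ℝ)) (h0 : ∀ n x, 0 ≤ θ n x) (h1 : ∀ n x, θ n x ≤ 1)
    (hlim : ∀ x, Tendsto (fun n => θ n x) atTop (𝓝 1))
    (htight : Tendsto (fun n => L (1 - (θ n : T →ᵇ ℝ))) atTop (𝓝 0)) :
    ∃ γ : Measure T, IsFiniteMeasure γ ∧ ∀ h : T →ᵇ ℝ, ∫ x, h x ∂γ = L h := by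
  have hmono : ∀ f g : T →ᵇ ℝ, (∀ x, f x ≤ g x) → L f ≤ L g := fun f g h => by
    have := hL (g - f) fun x => by simpa using h x
    rw [map_sub] at this
    linarith
  let ι : C_c(T, ℝ) →ₗ[ℝ] (T →ᵇ ℝ) :=
    { toFun := fun f => (f : T →ᵇ ℝ)
      map_add' := fun f g => rfl
      map_smul' := fun c f => rfl }
  let Λ : C_c(T, ℝ) →ₚ[ℝ] ℝ := PositiveLinearMap.mk₀ (L ∘ₗ ι) fun f hf => hL _ hf
  have hΛ : ∀ f : C_c(T, ℝ), Λ f = L (f : T →ᵇ ℝ) := fun f => rfl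
  let γ := RealRMK.rieszMeasure Λ
  have hγ : ∀ f : C_c(T, ℝ), ∫ x, f x ∂γ = L (f : T →ᵇ ℝ) := fun f =>
    RealRMK.integral_rieszMeasure Λ f
  have hint : ∀ f : C_c(T, ℝ), Integrable f γ := fun f =>
    f.continuous.integrable_of_hasCompactSupport f.hasCompactSupport
  -- Fatou's lemma along the cutoffs bounds the total mass by L 1.
  have hfin : IsFiniteMeasure γ := by
    refine ⟨lt_of_le_of_lt ?_ (ENNReal.ofReal_lt_top (r := L 1))⟩
    calc γ Set.univ = ∫⁻ x, 1 ∂γ := by simp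
      _ = ∫⁻ x, liminf (fun n => ENNReal.ofReal (θ n x)) atTop ∂γ := by
        refine lintegral_congr fun x => ?_
        have := (ENNReal.continuous_ofReal.tendsto 1).comp (hlim x)
        rw [ENNReal.ofReal_one] at this
        exact this.liminf_eq.symm
      _ ≤ liminf (fun n => ∫⁻ x, ENNReal.ofReal (θ n x) ∂γ) atTop :=
        lintegral_liminf_le fun n => ((θ n).continuous.measurable).ennreal_ofReal
      _ ≤ ENNReal.ofReal (L 1) := by
        refine liminf_le_of_frequently_le' (Frequently.of_forall fun n => ?_)
        rw [← ofReal_integral_eq_lintegral_ofReal (hint _) (Eventually.of_forall (h0 n)), hγ]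
        exact ENNReal.ofReal_le_ofReal (hmono _ _ (h1 n))
  refine ⟨γ, hfin, fun h => ?_⟩
  let hθ : ℕ → C_c(T, ℝ) := fun n =>
    ⟨⟨fun x => h x * θ n x, by fun_prop⟩, (θ n).hasCompactSupport.mul_left⟩
  have e1 : Tendsto (fun n => ∫ x, hθ n x ∂γ) atTop (𝓝 (∫ x, h x ∂γ)) := by
    refine tendsto_integral_of_dominated_convergence (fun _ => ‖h‖)
      (fun n => (hθ n).continuous.aestronglyMeasurable) (integrable_const _) (fun n => ?_) ?_
    · refine Eventually.of_forall fun x => ?_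
      have : ‖hθ n x‖ = ‖h x‖ * θ n x := by
        change ‖h x * θ n x‖ = _
        rw [norm_mul, Real.norm_of_nonneg (h0 n x)]
      rw [this]
      exact (mul_le_of_le_one_right (norm_nonneg _) (h1 n x)).trans (h.norm_coe_le_norm x)
    · refine Eventually.of_forall fun x => ?_
      have := (hlim x).const_mul (h x)
      rwa [mul_one] at this
  -- Positivity gives |L(hθₙ) - L h| ≤ ‖h‖ L(1 - θₙ), which is where tightness enters.
  have e2 : Tendsto (fun n => L (hθ n : T →ᵇ ℝ)) atTop (𝓝 (L h)) := by
    rw [tendsto_iff_dist_tendsto_zero]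
    have htight' := htight.const_mul ‖h‖
    rw [mul_zero] at htight'
    refine squeeze_zero (fun _ => dist_nonneg) (fun n => ?_) htight'
    rw [Real.dist_eq, ← map_sub, ← smul_eq_mul, ← map_smul]
    have hb : ∀ x, |h x| ≤ ‖h‖ := fun x => h.norm_coe_le_norm x
    have key : ∀ x, |h x * θ n x - h x| ≤ ‖h‖ * (1 - θ n x) := fun x => by
      rw [show h x * θ n x - h x = -(h x * (1 - θ n x)) by ring, abs_neg, abs_mul,
        abs_of_nonneg (sub_nonneg.2 (h1 n x))]
      exact mul_le_mul_of_nonneg_right (hb x) (sub_nonneg.2 (h1 n x))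
    refine abs_le'.2 ⟨hmono _ _ fun x => ?_, ?_⟩
    · exact (abs_le'.1 (key x)).1
    · rw [← map_neg]
      exact hmono _ _ fun x => (abs_le'.1 (key x)).2
  simp only [hγ] at e1
  exact tendsto_nhds_unique e1 e2

/-- A positive linear functional on bounded continuous functions on a product whose marginals are
integration against probability measures is integration against a coupling of these. -/
theorem exists_coupling_integral_eq {S : Type*} [TopologicalSpace S] [T2Space S]
    [LocallyCompactSpace S] [SecondCountableTopology S] [MeasurableSpace S] [BorelSpace S]
    (μ ν : Measure S) [IsProbabilityMeasure μ] [IsProbabilityMeasure ν]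
    (L : (S × S →ᵇ ℝ) →ₗ[ℝ] ℝ) (hL : ∀ h : S × S →ᵇ ℝ, (∀ x, 0 ≤ h x) → 0 ≤ L h)
    (hfst : ∀ φ : S →ᵇ ℝ, L (φ.compContinuous ⟨Prod.fst, continuous_fst⟩) = ∫ x, φ x ∂μ)
    (hsnd : ∀ ψ : S →ᵇ ℝ, L (ψ.compContinuous ⟨Prod.snd, continuous_snd⟩) = ∫ x, ψ x ∂ν) :
    ∃ γ : Measure (S × S), γ.map Prod.fst = μ ∧ γ.map Prod.snd = ν ∧
      ∀ h : S × S →ᵇ ℝ, ∫ x, h x ∂γ = L h := by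
  obtain ⟨χ, h0, h1, hlim⟩ := exists_cutoff_seq S
  let θ : ℕ → C_c(S × S, ℝ) := fun n =>
    ⟨⟨fun z => χ n z.1 * χ n z.2, by fun_prop⟩, by
      refine HasCompactSupport.intro ((χ n).hasCompactSupport.prod (χ n).hasCompactSupport)
        fun z hz => ?_
      rw [Set.mem_prod, not_and_or] at hz
      rcases hz with hz | hz
      · exact mul_eq_zero_of_left (image_eq_zero_of_notMem_tsupport hz) _
      · exact mul_eq_zero_of_right _ (image_eq_zero_of_notMem_tsupport hz)⟩
  have hθ : ∀ n z, θ n z = χ n z.1 * χ n z.2 := fun n z => rfl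
  have htail : ∀ ρ : Measure S, IsProbabilityMeasure ρ →
      Tendsto (fun n => ∫ x, (1 - (χ n : S →ᵇ ℝ)) x ∂ρ) atTop (𝓝 0) := by
    intro ρ _
    have := tendsto_integral_of_dominated_convergence (μ := ρ) (f := fun _ => (0 : ℝ))
      (F := fun n x => (1 - (χ n : S →ᵇ ℝ)) x) (fun _ => 1)
      (fun n => (1 - (χ n : S →ᵇ ℝ)).continuous.aestronglyMeasurable) (integrable_const _)
      (fun n => Eventually.of_forall fun x => ?_) (Eventually.of_forall fun x => ?_)
    · simpa using this
    · change ‖1 - χ n x‖ ≤ 1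
      rw [Real.norm_of_nonneg (sub_nonneg.2 (h1 n x))]
      linarith [h0 n x]
    · change Tendsto (fun n => 1 - χ n x) atTop (𝓝 0)
      have := (hlim x).const_sub 1
      rwa [sub_self] at this
  obtain ⟨γ, hγ, hint⟩ := exists_measure_integral_eq L hL θ
    (fun n z => mul_nonneg (h0 n _) (h0 n _))
    (fun n z => mul_le_one₀ (h1 n _) (h0 n _) (h1 n _))
    (fun z => by simpa [hθ] using (hlim z.1).mul (hlim z.2)) (by
      -- Tightness comes from the marginals: 1 - ab ≤ (1 - a) + (1 - b) for a, b in [0,1].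
      have hs := (htail μ inferInstance).add (htail ν inferInstance)
      rw [add_zero] at hs
      refine squeeze_zero (fun n => hL _ fun z => ?_) (fun n => ?_) hs
      · change 0 ≤ 1 - χ n z.1 * χ n z.2
        exact sub_nonneg.2 (mul_le_one₀ (h1 n _) (h0 n _) (h1 n _))
      · rw [← hfst, ← hsnd, ← map_add, ← sub_nonneg, ← map_sub]
        refine hL _ fun z => ?_
        change 0 ≤ (1 - χ n z.1) + (1 - χ n z.2) - (1 - χ n z.1 * χ n z.2)
        nlinarith [mul_nonneg (sub_nonneg.2 (h1 n z.1)) (sub_nonneg.2 (h1 n z.2))])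
  refine ⟨γ, ?_, ?_, hint⟩
  · refine ext_of_forall_integral_eq_of_IsFiniteMeasure fun f => ?_
    rw [integral_map measurable_fst.aemeasurable f.continuous.aestronglyMeasurable, ← hfst, ← hint]
    rfl
  · refine ext_of_forall_integral_eq_of_IsFiniteMeasure fun f => ?_
    rw [integral_map measurable_snd.aemeasurable f.continuous.aestronglyMeasurable, ← hsnd, ← hint]
    rfl

/-- The value of the functional dual to the optimal transport problem: the least total integral
of a function `φ ⊕ ψ` above `h`. -/
def transportDual {S : Type*} [TopologicalSpace S] [MeasurableSpace S] (μ ν : Measure S)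
    (h : S × S →ᵇ ℝ) : ℝ :=
  sInf {r | ∃ φ ψ : S →ᵇ ℝ, (∀ x y, h (x, y) ≤ φ x + ψ y) ∧ r = ∫ x, φ x ∂μ + ∫ y, ψ y ∂ν}

section TransportDual

theorem isProbabilityMeasure_of_map_fst {S : Type*} [MeasurableSpace S] (μ : Measure S)
    [IsProbabilityMeasure μ] {γ : Measure (S × S)} (h1 : γ.map Prod.fst = μ) :
    IsProbabilityMeasure γ := by
  refine ⟨?_⟩
  have := measure_univ (μ := μ)
  rwa [← h1, Measure.map_apply measurable_fst MeasurableSet.univ] at this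

variable {S : Type*} [TopologicalSpace S] [MeasurableSpace S] (μ ν : Measure S)

theorem exists_lt_transportDual (h : S × S →ᵇ ℝ) {ε : ℝ} (hε : 0 < ε) :
    ∃ φ ψ : S →ᵇ ℝ, (∀ x y, h (x, y) ≤ φ x + ψ y) ∧
      ∫ x, φ x ∂μ + ∫ y, ψ y ∂ν < transportDual μ ν h + ε := by
  have hne : {r | ∃ φ ψ : S →ᵇ ℝ, (∀ x y, h (x, y) ≤ φ x + ψ y) ∧
      r = ∫ x, φ x ∂μ + ∫ y, ψ y ∂ν}.Nonempty := by
    refine ⟨_, BoundedContinuousFunction.const S ‖h‖, 0, fun x y => ?_, rfl⟩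
    simpa using (le_abs_self _).trans (h.norm_coe_le_norm (x, y))
  obtain ⟨_, ⟨φ, ψ, hle, rfl⟩, hlt⟩ := Real.lt_sInf_add_pos hne hε
  exact ⟨φ, ψ, hle, hlt⟩

variable [BorelSpace S] [IsProbabilityMeasure μ] [IsProbabilityMeasure ν]

theorem integral_add_integral_eq_of_coupling {γ : Measure (S × S)} (h1 : γ.map Prod.fst = μ)
    (h2 : γ.map Prod.snd = ν) (φ ψ : S →ᵇ ℝ) :
    ∫ x, φ x ∂μ + ∫ y, ψ y ∂ν = ∫ z, (φ z.1 + ψ z.2) ∂γ := by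
  subst h1 h2
  rw [integral_map measurable_fst.aemeasurable φ.continuous.measurable.aestronglyMeasurable,
    integral_map measurable_snd.aemeasurable ψ.continuous.measurable.aestronglyMeasurable,
    integral_add]
  · exact (φ.integrable _).comp_measurable measurable_fst
  · exact (ψ.integrable _).comp_measurable measurable_snd

variable [SecondCountableTopology S]

theorem integral_le_of_le_add {γ : Measure (S × S)} (h1 : γ.map Prod.fst = μ)
    (h2 : γ.map Prod.snd = ν) {φ ψ : S →ᵇ ℝ} {h : S × S →ᵇ ℝ}
    (hle : ∀ x y, h (x, y) ≤ φ x + ψ y) : ∫ z, h z ∂γ ≤ ∫ x, φ x ∂μ + ∫ y, ψ y ∂ν := by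
  have := isProbabilityMeasure_of_map_fst μ h1
  rw [integral_add_integral_eq_of_coupling μ ν h1 h2]
  subst h1 h2
  exact integral_mono (h.integrable _) (((φ.integrable _).comp_measurable measurable_fst).add
    ((ψ.integrable _).comp_measurable measurable_snd)) fun z => hle z.1 z.2

/-- The product measure is a coupling, so the integral of h against it is a lower bound. Without a
lower bound the real `sInf` would take its default value 0. -/
theorem bddBelow_transportDual (h : S × S →ᵇ ℝ) : BddBelow {r | ∃ φ ψ : S →ᵇ ℝ,
    (∀ x y, h (x, y) ≤ φ x + ψ y) ∧ r = ∫ x, φ x ∂μ + ∫ y, ψ y ∂ν} := by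
  refine ⟨∫ z, h z ∂(μ.prod ν), ?_⟩
  rintro _ ⟨φ, ψ, hle, rfl⟩
  exact integral_le_of_le_add μ ν (by simp) (by simp) hle

theorem transportDual_le {h : S × S →ᵇ ℝ} {φ ψ : S →ᵇ ℝ} (hle : ∀ x y, h (x, y) ≤ φ x + ψ y) :
    transportDual μ ν h ≤ ∫ x, φ x ∂μ + ∫ y, ψ y ∂ν :=
  csInf_le (bddBelow_transportDual μ ν h) ⟨φ, ψ, hle, rfl⟩

theorem transportDual_add_le (g h : S × S →ᵇ ℝ) :
    transportDual μ ν (g + h) ≤ transportDual μ ν g + transportDual μ ν h := by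
  refine le_of_forall_pos_le_add fun ε hε => ?_
  obtain ⟨φ, ψ, hle, hlt⟩ := exists_lt_transportDual μ ν g (half_pos hε)
  obtain ⟨φ', ψ', hle', hlt'⟩ := exists_lt_transportDual μ ν h (half_pos hε)
  have := transportDual_le μ ν (h := g + h) (φ := φ + φ') (ψ := ψ + ψ') fun x y => by
    simp only [BoundedContinuousFunction.coe_add, Pi.add_apply]
    linarith [hle x y, hle' x y]
  simp only [BoundedContinuousFunction.coe_add, Pi.add_apply] at this
  rw [integral_add (φ.integrable _) (φ'.integrable _),
    integral_add (ψ.integrable _) (ψ'.integrable _)] at this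
  linarith

theorem transportDual_smul {c : ℝ} (hc : 0 < c) (h : S × S →ᵇ ℝ) :
    transportDual μ ν (c • h) = c * transportDual μ ν h := by
  have key : ∀ (c : ℝ), 0 < c → ∀ h : S × S →ᵇ ℝ,
      transportDual μ ν (c • h) ≤ c * transportDual μ ν h := by
    intro c hc h
    refine le_of_forall_pos_le_add fun ε hε => ?_
    obtain ⟨φ, ψ, hle, hlt⟩ := exists_lt_transportDual μ ν h (div_pos hε hc)
    have := transportDual_le μ ν (h := c • h) (φ := c • φ) (ψ := c • ψ) fun x y => by
      simp only [BoundedContinuousFunction.coe_smul, smul_eq_mul, ← mul_add]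
      exact mul_le_mul_of_nonneg_left (hle x y) hc.le
    simp only [BoundedContinuousFunction.coe_smul, smul_eq_mul, integral_const_mul] at this
    have h2 := mul_lt_mul_of_pos_left hlt hc
    rw [mul_add, mul_add, mul_div_cancel₀ _ hc.ne'] at h2
    linarith
  refine (key c hc h).antisymm ?_
  have := mul_le_mul_of_nonneg_left (key c⁻¹ (inv_pos.2 hc) (c • h)) hc.le
  rwa [inv_smul_smul₀ hc.ne', mul_inv_cancel_left₀ hc.ne'] at this

/-- Homogeneity with factor 2 gives p(0) = 2 p(0). -/
theorem transportDual_zero : transportDual μ ν 0 = 0 := by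
  have := transportDual_smul μ ν two_pos 0
  rw [smul_zero] at this
  linarith

/-- Hahn–Banach, starting from t • c ↦ t p(c) on the line through c. For t < 0 this is dominated by
p because 0 = p(0) ≤ p(t • c) + p(-t • c). -/
theorem exists_linearMap_le_transportDual (c : S × S →ᵇ ℝ) :
    ∃ L : (S × S →ᵇ ℝ) →ₗ[ℝ] ℝ, L c = transportDual μ ν c ∧ ∀ h, L h ≤ transportDual μ ν h := by
  have h0 := transportDual_zero μ ν
  let f : (S × S →ᵇ ℝ) →ₗ.[ℝ] ℝ := LinearPMap.mkSpanSingleton' c (transportDual μ ν c) fun t ht => by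
    rcases smul_eq_zero.1 ht with rfl | rfl
    · simp
    · simp [h0]
  obtain ⟨L, hf, hle⟩ := exists_extension_of_le_sublinear f (transportDual μ ν)
    (fun t ht h => transportDual_smul μ ν ht h) (transportDual_add_le μ ν) (by
      rintro ⟨x, hx⟩
      obtain ⟨t, rfl⟩ := Submodule.mem_span_singleton.1 hx
      rw [LinearPMap.mkSpanSingleton'_apply]
      change t * _ ≤ transportDual μ ν (t • c)
      rcases lt_trichotomy t 0 with ht | rfl | ht
      · have h1 := transportDual_add_le μ ν (t • c) ((-t) • c)
        rw [← add_smul, add_neg_cancel, zero_smul, h0,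
          transportDual_smul μ ν (neg_pos.2 ht)] at h1
        linarith
      · simp [h0]
      · exact (transportDual_smul μ ν ht c).ge)
  refine ⟨L, ?_, hle⟩
  exact (hf ⟨c, Submodule.mem_span_singleton_self c⟩).trans
    (LinearPMap.mkSpanSingleton'_apply_self _ _ _ _)

/-- **Kantorovich duality** for a bounded continuous cost, with an attained minimum. -/
theorem exists_coupling_integral_le [T2Space S] [LocallyCompactSpace S] (c : S × S →ᵇ ℝ) :
    ∃ γ : Measure (S × S), γ.map Prod.fst = μ ∧ γ.map Prod.snd = ν ∧
      ∀ ε > 0, ∃ φ ψ : S →ᵇ ℝ, (∀ x y, φ x + ψ y ≤ c (x, y)) ∧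
        ∫ z, c z ∂γ ≤ ∫ x, φ x ∂μ + ∫ y, ψ y ∂ν + ε := by
  -- The functional p bounds from above, whereas the dual problem for c asks for φ ⊕ ψ ≤ c; hence
  -- the sign, and L c = -p(-c) is the supremum of the dual problem.
  obtain ⟨L, hLc, hL⟩ := exists_linearMap_le_transportDual μ ν (-c)
  -- Domination by p at both h and -h forces equality on sums φ ⊕ ψ.
  have hadd : ∀ φ ψ : S →ᵇ ℝ, ∀ h : S × S →ᵇ ℝ, (∀ x y, h (x, y) = φ x + ψ y) →
      L h = ∫ x, φ x ∂μ + ∫ y, ψ y ∂ν := by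
    intro φ ψ h hh
    refine le_antisymm ((hL h).trans (transportDual_le μ ν fun x y => (hh x y).le)) ?_
    have := (hL (-h)).trans (transportDual_le μ ν (φ := -φ) (ψ := -ψ) fun x y => by
      simp only [BoundedContinuousFunction.coe_neg, Pi.neg_apply, hh]
      linarith)
    simp only [map_neg, BoundedContinuousFunction.coe_neg, Pi.neg_apply, integral_neg] at this
    linarith
  obtain ⟨γ, h1, h2, hγ⟩ := exists_coupling_integral_eq μ ν L (fun h hh => by
      have := (hL (-h)).trans (transportDual_le μ ν (φ := 0) (ψ := 0) fun x y => by
        simpa using hh (x, y))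
      simpa using this)
    (fun φ => by rw [hadd φ 0 _ fun x y => by simp]; simp)
    (fun ψ => by rw [hadd 0 ψ _ fun x y => by simp]; simp)
  refine ⟨γ, h1, h2, fun ε hε => ?_⟩
  obtain ⟨φ, ψ, hle, hlt⟩ := exists_lt_transportDual μ ν (-c) hε
  refine ⟨-φ, -ψ, fun x y => ?_, ?_⟩
  · have := hle x y
    simp only [BoundedContinuousFunction.coe_neg, Pi.neg_apply] at this ⊢
    linarith
  · rw [map_neg] at hLc
    simp only [hγ, BoundedContinuousFunction.coe_neg, Pi.neg_apply, integral_neg]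
    linarith

end TransportDual

/-- For a bounded continuous cost the infimum over all couplings is attained. -/
theorem isLeast_sInf_couplingCosts {S : Type*} [TopologicalSpace S] [T2Space S]
    [LocallyCompactSpace S] [SecondCountableTopology S] [MeasurableSpace S] [BorelSpace S]
    (c : S → S → ℝ) (hc : Continuous fun z : S × S => c z.1 z.2) {C : ℝ}
    (hC : ∀ x y, |c x y| ≤ C) (μ ν : Measure S) [IsProbabilityMeasure μ]
    [IsProbabilityMeasure ν] :
    IsLeast (couplingCosts c μ ν) (sInf (couplingCosts c μ ν)) := by
  let c' : S × S →ᵇ ℝ := BoundedContinuousFunction.ofNormedAddCommGroup _ hc C fun z => hC z.1 z.2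
  obtain ⟨γ, h1, h2, hγ⟩ := exists_coupling_integral_le μ ν c'
  have : IsLeast (couplingCosts c μ ν) (∫ z, c z.1 z.2 ∂γ) := by
    refine ⟨⟨γ, h1, h2, rfl⟩, ?_⟩
    rintro _ ⟨γ', h1', h2', rfl⟩
    refine le_of_forall_pos_le_add fun ε hε => ?_
    obtain ⟨φ, ψ, hle, hlt⟩ := hγ ε hε
    refine hlt.trans (add_le_add_left ?_ ε)
    have := isProbabilityMeasure_of_map_fst μ h1'
    rw [integral_add_integral_eq_of_coupling μ ν h1' h2']
    subst h1' h2'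
    exact integral_mono (((φ.integrable _).comp_measurable measurable_fst).add
      ((ψ.integrable _).comp_measurable measurable_snd)) (c'.integrable _) fun z => hle z.1 z.2
  rwa [this.csInf_eq]

/-! ### Kantorovich–Rubinstein duality -/

/-- The largest difference of the integrals of a `[0, 1]`-valued function that is 1-Lipschitz with
respect to `d`. -/
def lipschitzDual {S : Type*} [MeasurableSpace S] (d : S → S → ℝ) (P Q : Measure S) : ℝ :=
  sSup {r | ∃ f : S → ℝ, (∀ x, f x ∈ Set.Icc (0 : ℝ) 1) ∧ (∀ x y, |f x - f y| ≤ d x y) ∧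
    r = |∫ x, f x ∂P - ∫ x, f x ∂Q|}

/-- No measurability is needed: a function that is not integrable has integral 0. So the suprema
over Lipschitz functions are bounded whatever `d` is. -/
theorem integral_mem_Icc {S : Type*} [MeasurableSpace S] (P : Measure S) [IsProbabilityMeasure P]
    {f : S → ℝ} (hf : ∀ x, f x ∈ Set.Icc (0 : ℝ) 1) : ∫ x, f x ∂P ∈ Set.Icc (0 : ℝ) 1 := by
  refine ⟨integral_nonneg fun x => (hf x).1, ?_⟩
  refine (integral_mono_of_nonneg (Eventually.of_forall fun x => (hf x).1) (integrable_const 1)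
    (Eventually.of_forall fun x => (hf x).2)).trans ?_
  simp

section LipschitzDual

variable {S : Type*} [MeasurableSpace S] {d d' : S → S → ℝ} {P Q : Measure S}

theorem bddAbove_lipschitzDual [IsProbabilityMeasure P] [IsProbabilityMeasure Q] :
    BddAbove {r | ∃ f : S → ℝ, (∀ x, f x ∈ Set.Icc (0 : ℝ) 1) ∧ (∀ x y, |f x - f y| ≤ d x y) ∧
      r = |∫ x, f x ∂P - ∫ x, f x ∂Q|} := by
  refine ⟨1, ?_⟩
  rintro _ ⟨f, hf, -, rfl⟩
  have h1 := integral_mem_Icc P hf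
  have h2 := integral_mem_Icc Q hf
  rw [abs_le]
  constructor <;> linarith [h1.1, h1.2, h2.1, h2.2]

theorem le_lipschitzDual [IsProbabilityMeasure P] [IsProbabilityMeasure Q] {f : S → ℝ}
    (hf : ∀ x, f x ∈ Set.Icc (0 : ℝ) 1) (hl : ∀ x y, |f x - f y| ≤ d x y) :
    |∫ x, f x ∂P - ∫ x, f x ∂Q| ≤ lipschitzDual d P Q :=
  le_csSup bddAbove_lipschitzDual ⟨f, hf, hl, rfl⟩

theorem lipschitzDual_le (hd : ∀ x y, 0 ≤ d x y) {a : ℝ}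
    (h : ∀ f : S → ℝ, (∀ x, f x ∈ Set.Icc (0 : ℝ) 1) → (∀ x y, |f x - f y| ≤ d x y) →
      |∫ x, f x ∂P - ∫ x, f x ∂Q| ≤ a) : lipschitzDual d P Q ≤ a := by
  refine csSup_le ⟨_, 0, fun _ => by simp, fun x y => by simpa using hd x y, rfl⟩ ?_
  rintro _ ⟨f, hf, hl, rfl⟩
  exact h f hf hl

theorem lipschitzDual_nonneg : 0 ≤ lipschitzDual d P Q := by
  refine Real.sSup_nonneg ?_
  rintro _ ⟨f, -, -, rfl⟩
  exact abs_nonneg _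

theorem lipschitzDual_mono [IsProbabilityMeasure P] [IsProbabilityMeasure Q]
    (hd : ∀ x y, 0 ≤ d x y) (h : ∀ x y, d x y ≤ d' x y) :
    lipschitzDual d P Q ≤ lipschitzDual d' P Q :=
  lipschitzDual_le hd fun _ hf hl => le_lipschitzDual hf fun x y => (hl x y).trans (h x y)

theorem lipschitzDual_comm : lipschitzDual d P Q = lipschitzDual d Q P := by
  simp only [lipschitzDual, abs_sub_comm (∫ x, _ ∂P)]

theorem lipschitzDual_self : lipschitzDual d P P = 0 := by
  refine le_antisymm (Real.sSup_nonpos ?_) lipschitzDual_nonneg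
  rintro _ ⟨f, -, -, rfl⟩
  simp

theorem lipschitzDual_triangle [IsProbabilityMeasure P] [IsProbabilityMeasure Q] {R : Measure S}
    [IsProbabilityMeasure R] (hd : ∀ x y, 0 ≤ d x y) :
    lipschitzDual d P R ≤ lipschitzDual d P Q + lipschitzDual d Q R :=
  lipschitzDual_le hd fun _ hf hl => (abs_sub_le _ _ _).trans
    (add_le_add (le_lipschitzDual hf hl) (le_lipschitzDual hf hl))

end LipschitzDual

section Metric

theorem continuous_of_abs_sub_le_dist {S : Type*} [MetricSpace S] {f : S → ℝ} (hl : ∀ x y, |f x - f y| ≤ dist x y) :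
    Continuous f :=
  (LipschitzWith.of_dist_le_mul (K := 1) fun x y => by
    simpa [Real.dist_eq] using hl x y).continuous

variable {S : Type*} [MetricSpace S] [MeasurableSpace S] [BorelSpace S]

theorem abs_integral_sub_integral_le_of_coupling [SecondCountableTopology S]
    (hS : ∀ x y : S, dist x y ≤ 1) {P Q : Measure S}
    [IsProbabilityMeasure P] [IsProbabilityMeasure Q] {γ : Measure (S × S)}
    (h1 : γ.map Prod.fst = P) (h2 : γ.map Prod.snd = Q) {f : S → ℝ}
    (hf : ∀ x, f x ∈ Set.Icc (0 : ℝ) 1) (hl : ∀ x y, |f x - f y| ≤ dist x y) :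
    |∫ x, f x ∂P - ∫ x, f x ∂Q| ≤ ∫ z, dist z.1 z.2 ∂γ := by
  have hγ := isProbabilityMeasure_of_map_fst P h1
  have hc := continuous_of_abs_sub_le_dist hl
  have hb : ∀ x, ‖f x‖ ≤ 1 := fun x => by
    rw [Real.norm_of_nonneg (hf x).1]; exact (hf x).2
  subst h1 h2
  rw [integral_map measurable_fst.aemeasurable hc.aestronglyMeasurable,
    integral_map measurable_snd.aemeasurable hc.aestronglyMeasurable, ← integral_sub]
  · refine (abs_integral_le_integral_abs).trans (integral_mono_of_nonneg
      (Eventually.of_forall fun _ => abs_nonneg _) ?_ (Eventually.of_forall fun z => hl z.1 z.2))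
    exact Integrable.of_bound continuous_dist.aestronglyMeasurable 1
      (Eventually.of_forall fun z => by simpa using hS z.1 z.2)
  · exact Integrable.of_bound (hc.comp continuous_fst).aestronglyMeasurable 1
      (Eventually.of_forall fun z => hb _)
  · exact Integrable.of_bound (hc.comp continuous_snd).aestronglyMeasurable 1
      (Eventually.of_forall fun z => hb _)

/-- The infimal convolution f(x) = inf_y (d(x, y) - ψ(y)) is 1-Lipschitz by the triangle inequality,
lies above φ by hypothesis, and satisfies ψ ≤ -f by taking y = x. -/
theorem integral_add_integral_le_lipschitzDual (hS : ∀ x y : S, dist x y ≤ 1) {P Q : Measure S}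
    [IsProbabilityMeasure P] [IsProbabilityMeasure Q] (φ ψ : S →ᵇ ℝ)
    (hle : ∀ x y, φ x + ψ y ≤ dist x y) :
    ∫ x, φ x ∂P + ∫ y, ψ y ∂Q ≤ lipschitzDual dist P Q := by
  have : Nonempty S := nonempty_of_isProbabilityMeasure P
  have hψ : ∀ y, |ψ y| ≤ ‖ψ‖ := fun y => ψ.norm_coe_le_norm y
  have hbdd : ∀ x, BddBelow (Set.range fun y => dist x y - ψ y) := fun x => by
    refine ⟨-‖ψ‖, ?_⟩
    rintro _ ⟨y, rfl⟩
    change _ ≤ dist x y - ψ y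
    linarith [(abs_le.1 (hψ y)).2, dist_nonneg (x := x) (y := y)]
  let f : S → ℝ := fun x => ⨅ y, (dist x y - ψ y)
  have hf : ∀ x y, f x ≤ dist x y - ψ y := fun x y => ciInf_le (hbdd x) y
  have hsub : ∀ x x', f x - f x' ≤ dist x x' := fun x x' => by
    have : f x - dist x x' ≤ f x' := le_ciInf fun y => by
      linarith [hf x y, dist_triangle x x' y]
    linarith
  have hφf : ∀ x, φ x ≤ f x := fun x => le_ciInf fun y => by linarith [hle x y]
  have hfψ : ∀ x, ψ x ≤ -f x := fun x => by
    have := hf x x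
    rw [dist_self] at this
    linarith
  have hfl : ∀ x y, |f x - f y| ≤ dist x y := fun x y =>
    abs_le'.2 ⟨hsub x y, by rw [neg_sub, dist_comm]; exact hsub y x⟩
  have hfc := continuous_of_abs_sub_le_dist hfl
  have hfb : BddBelow (Set.range f) := by
    obtain ⟨x₀⟩ := this
    refine ⟨f x₀ - 1, ?_⟩
    rintro _ ⟨y, rfl⟩
    linarith [hsub x₀ y, hS x₀ y]
  -- As distances are at most 1, f oscillates by at most 1, and a shift puts it in [0,1]. The
  -- constant cancels between two probability measures.
  let g : S → ℝ := fun x => f x - ⨅ y, f y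
  have hg : ∀ x, g x ∈ Set.Icc (0 : ℝ) 1 := fun x => by
    refine ⟨sub_nonneg.2 (ciInf_le hfb x), ?_⟩
    have : f x - 1 ≤ ⨅ y, f y := le_ciInf fun y => by linarith [hsub x y, hS x y]
    change f x - _ ≤ 1
    linarith
  have hint : ∀ R : Measure S, IsProbabilityMeasure R → Integrable f R := fun R _ => by
    have : Integrable g R := Integrable.of_bound
      (hfc.sub continuous_const).aestronglyMeasurable 1 (Eventually.of_forall fun x => by
        rw [Real.norm_of_nonneg (hg x).1]; exact (hg x).2)
    exact (this.add (integrable_const (⨅ y, f y))).congr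
      (Eventually.of_forall fun x => sub_add_cancel _ _)
  have key := le_lipschitzDual (P := P) (Q := Q) (d := dist) hg fun x y => by
    simpa [g] using hfl x y
  have hP : ∫ x, g x ∂P = ∫ x, f x ∂P - ⨅ y, f y := by
    simp [g, integral_sub (hint P inferInstance) (integrable_const _)]
  have hQ : ∫ x, g x ∂Q = ∫ x, f x ∂Q - ⨅ y, f y := by
    simp [g, integral_sub (hint Q inferInstance) (integrable_const _)]
  rw [hP, hQ, sub_sub_sub_cancel_right] at key
  have h1 := integral_mono (φ.integrable P) (hint P inferInstance) hφf
  have h2 := integral_mono (ψ.integrable Q) (hint Q inferInstance).neg hfψ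
  simp only [Pi.neg_apply, integral_neg] at h2
  linarith [le_abs_self (∫ x, f x ∂P - ∫ x, f x ∂Q)]

/-- **Kantorovich–Rubinstein duality** for a metric bounded by `1`. -/
theorem isLeast_couplingCosts_lipschitzDual [LocallyCompactSpace S] [SecondCountableTopology S]
    (hS : ∀ x y : S, dist x y ≤ 1) (P Q : Measure S) [IsProbabilityMeasure P]
    [IsProbabilityMeasure Q] :
    IsLeast (couplingCosts dist P Q) (lipschitzDual dist P Q) := by
  have hlower : ∀ γ : Measure (S × S), γ.map Prod.fst = P → γ.map Prod.snd = Q →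
      lipschitzDual dist P Q ≤ ∫ z, dist z.1 z.2 ∂γ := fun γ h1 h2 =>
    lipschitzDual_le (fun _ _ => dist_nonneg) fun f hf hl =>
      abs_integral_sub_integral_le_of_coupling hS h1 h2 hf hl
  refine ⟨?_, ?_⟩
  · let c : S × S →ᵇ ℝ := BoundedContinuousFunction.ofNormedAddCommGroup
      (fun z => dist z.1 z.2) continuous_dist 1 fun z => by simpa using hS z.1 z.2
    obtain ⟨γ, h1, h2, hγ⟩ := exists_coupling_integral_le P Q c
    refine ⟨γ, h1, h2, (hlower γ h1 h2).antisymm (le_of_forall_pos_le_add fun ε hε => ?_)⟩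
    obtain ⟨φ, ψ, hle, hlt⟩ := hγ ε hε
    exact hlt.trans (add_le_add_left (integral_add_integral_le_lipschitzDual hS φ ψ hle) ε)
  · rintro _ ⟨γ, h1, h2, rfl⟩
    exact hlower γ h1 h2

/-! ### Comparison with the Lévy–Prokhorov distance -/

/-- Markov's inequality bounds the probability that the coupled points are at distance at least ε by
ε² / ε = ε; otherwise a first point in B puts the second in a thickening of B. -/
theorem levyProkhorovEDist_le_of_coupling [SecondCountableTopology S]
    (hS : ∀ x y : S, dist x y ≤ 1) {P Q : Measure S}
    [IsProbabilityMeasure P] [IsProbabilityMeasure Q] {γ : Measure (S × S)}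
    (h1 : γ.map Prod.fst = P) (h2 : γ.map Prod.snd = Q) {ε : ℝ} (hε : 0 < ε)
    (hγ : ∫ z, dist z.1 z.2 ∂γ ≤ ε * ε) : levyProkhorovEDist P Q ≤ ENNReal.ofReal ε := by
  have hprob := isProbabilityMeasure_of_map_fst P h1
  have hmarkov : γ {z | ε ≤ dist z.1 z.2} ≤ ENNReal.ofReal ε := by
    have hint : Integrable (fun z : S × S => dist z.1 z.2) γ :=
      Integrable.of_bound continuous_dist.aestronglyMeasurable 1
        (Eventually.of_forall fun z => by simpa using hS z.1 z.2)
    have := mul_meas_ge_le_integral_of_nonneg (Eventually.of_forall fun z => dist_nonneg) hint ε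
    rw [← ofReal_measureReal]
    exact ENNReal.ofReal_le_ofReal (le_of_mul_le_mul_left (this.trans hγ) hε)
  refine levyProkhorovEDist_le_of_forall_le P Q _ fun δ B hδ hδ' hB => ?_
  have hsub : Prod.fst ⁻¹' B ⊆
      Prod.snd ⁻¹' Metric.thickening δ.toReal B ∪ {z : S × S | ε ≤ dist z.1 z.2} := by
    intro z hz
    by_cases h : ε ≤ dist z.1 z.2
    · exact Or.inr h
    · refine Or.inl (Metric.mem_thickening_iff.2 ⟨z.1, hz, ?_⟩)
      rw [dist_comm]
      exact (not_le.1 h).trans_le ((ENNReal.ofReal_le_iff_le_toReal hδ'.ne).1 hδ.le)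
  rw [← h1, ← h2, Measure.map_apply measurable_fst hB,
    Measure.map_apply measurable_snd Metric.isOpen_thickening.measurableSet]
  exact (measure_mono hsub).trans ((measure_union_le _ _).trans
    (add_le_add_right (hmarkov.trans hδ.le) _))

/-- By the layer-cake formula, ∫ f dP is at most the integral over t of the Q-mass of the
ε-thickening of {f ≥ t}, plus ε‖f‖. As f is 1-Lipschitz, this thickening lies in {f + ε ≥ t}, so the
first term is at most ∫ f dQ + ε. -/
theorem integral_sub_integral_le_of_levyProkhorovEDist_lt {P Q : Measure S}
    [IsProbabilityMeasure P] [IsProbabilityMeasure Q] {ε : ℝ} (hε : 0 < ε)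
    (h : levyProkhorovEDist P Q < ENNReal.ofReal ε) {f : S → ℝ}
    (hf : ∀ x, f x ∈ Set.Icc (0 : ℝ) 1) (hl : ∀ x y, |f x - f y| ≤ dist x y) :
    ∫ x, f x ∂P - ∫ x, f x ∂Q ≤ 2 * ε := by
  have : Nonempty S := nonempty_of_isProbabilityMeasure P
  have hc := continuous_of_abs_sub_le_dist hl
  let g : S →ᵇ ℝ := BoundedContinuousFunction.ofNormedAddCommGroup f hc 1 fun x => by
    rw [Real.norm_of_nonneg (hf x).1]; exact (hf x).2
  have hgn : ‖g‖ ≤ 1 := BoundedContinuousFunction.norm_ofNormedAddCommGroup_le hc zero_le_one _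
  have key := BoundedContinuousFunction.integral_le_of_levyProkhorovEDist_lt P Q hε h g
    (Eventually.of_forall fun x => (hf x).1)
  let k : S →ᵇ ℝ := g + BoundedContinuousFunction.const S ε
  have hk : ∀ x, k x = f x + ε := fun x => rfl
  have hgk : ‖g‖ ≤ ‖k‖ := by
    refine (BoundedContinuousFunction.norm_le (norm_nonneg _)).2 fun x => ?_
    have h1 := k.norm_coe_le_norm x
    have h2 : ‖g x‖ = f x := Real.norm_of_nonneg (hf x).1
    rw [hk, Real.norm_of_nonneg (by linarith [(hf x).1])] at h1
    linarith
  have hk' := BoundedContinuousFunction.integral_eq_integral_meas_le k Q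
    (Eventually.of_forall fun x => by
      change 0 ≤ f x + ε
      linarith [(hf x).1])
  have hint : IntegrableOn (fun t => Q.real {x | t ≤ k x}) (Set.Ioc 0 ‖k‖) := by
    refine Measure.integrableOn_of_bounded (M := 1) measure_Ioc_lt_top.ne ?_
      (Eventually.of_forall fun t => ?_)
    · have hanti : Antitone fun t => Q {x | t ≤ k x} := fun _ _ hst =>
        measure_mono fun _ h => hst.trans h
      exact hanti.measurable.ennreal_toReal.aestronglyMeasurable
    · rw [Real.norm_of_nonneg measureReal_nonneg]
      exact measureReal_le_one
  have hle : ∫ t in Set.Ioc 0 ‖g‖, Q.real (Metric.thickening ε {x | t ≤ g x}) ≤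
      ∫ x, f x ∂Q + ε := by
    calc _ ≤ ∫ t in Set.Ioc 0 ‖g‖, Q.real {x | t ≤ k x} := by
          refine integral_mono_of_nonneg (Eventually.of_forall fun _ => measureReal_nonneg)
            (hint.mono_set (Set.Ioc_subset_Ioc_right hgk)) (Eventually.of_forall fun t => ?_)
          refine measureReal_mono fun x hx => ?_
          obtain ⟨y, hy, hxy⟩ := Metric.mem_thickening_iff.1 hx
          change t ≤ f y at hy
          change t ≤ f x + ε
          have := (abs_le.1 (hl x y)).1
          linarith
      _ ≤ ∫ t in Set.Ioc 0 ‖k‖, Q.real {x | t ≤ k x} :=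
          setIntegral_mono_set hint (Eventually.of_forall fun _ => measureReal_nonneg)
            (Set.Ioc_subset_Ioc_right hgk).eventuallyLE
      _ = ∫ x, f x ∂Q + ε := by
          rw [← hk']
          simp only [hk]
          have hfQ : Integrable f Q := g.integrable Q
          rw [integral_add hfQ (integrable_const ε)]
          simp
  have hk2 : ε * ‖g‖ ≤ ε := mul_le_of_le_one_right hε.le hgn
  change ∫ x, f x ∂P ≤ _ at key
  linarith

theorem lipschitzDual_le_of_levyProkhorovEDist_lt {P Q : Measure S}
    [IsProbabilityMeasure P] [IsProbabilityMeasure Q] {ε : ℝ} (hε : 0 < ε)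
    (h : levyProkhorovEDist P Q < ENNReal.ofReal ε) : lipschitzDual dist P Q ≤ 2 * ε :=
  lipschitzDual_le (fun _ _ => dist_nonneg) fun f hf hl => by
    rw [abs_le']
    refine ⟨integral_sub_integral_le_of_levyProkhorovEDist_lt hε h hf hl, ?_⟩
    rw [neg_sub]
    rw [levyProkhorovEDist_comm] at h
    exact integral_sub_integral_le_of_levyProkhorovEDist_lt hε h hf hl

theorem dist_ofMeasure_le_of_lipschitzDual_le [LocallyCompactSpace S]
    [SecondCountableTopology S] (hS : ∀ x y : S, dist x y ≤ 1) (P Q : ProbabilityMeasure S)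
    {ε : ℝ} (hε : 0 < ε) (h : lipschitzDual dist (P : Measure S) Q ≤ ε * ε) :
    dist (LevyProkhorov.ofMeasure P) (LevyProkhorov.ofMeasure Q) ≤ ε := by
  obtain ⟨γ, h1, h2, hγ⟩ := (isLeast_couplingCosts_lipschitzDual hS (P : Measure S) Q).1
  have := levyProkhorovEDist_le_of_coupling hS h1 h2 hε (hγ ▸ h)
  rw [LevyProkhorov.dist_probabilityMeasure_def]
  exact ENNReal.toReal_le_of_le_ofReal hε.le this

theorem lipschitzDual_lt_of_dist_ofMeasure_lt (P Q : ProbabilityMeasure S) {δ : ℝ} (hδ : 0 < δ)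
    (h : dist (LevyProkhorov.ofMeasure P) (LevyProkhorov.ofMeasure Q) < δ / 4) :
    lipschitzDual dist (P : Measure S) Q < δ := by
  rw [LevyProkhorov.dist_probabilityMeasure_def] at h
  have h' : levyProkhorovEDist (P : Measure S) Q < ENNReal.ofReal (δ / 4) :=
    (ENNReal.lt_ofReal_iff_toReal_lt (levyProkhorovEDist_ne_top _ _)).2 h
  refine (lipschitzDual_le_of_levyProkhorovEDist_lt (by positivity) h').trans_lt ?_
  linarith

theorem eq_of_lipschitzDual_eq_zero [LocallyCompactSpace S]
    [SecondCountableTopology S] (hS : ∀ x y : S, dist x y ≤ 1) {P Q : ProbabilityMeasure S}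
    (h : lipschitzDual dist (P : Measure S) Q = 0) : P = Q := by
  have h0 : dist (LevyProkhorov.ofMeasure P) (LevyProkhorov.ofMeasure Q) ≤ 0 :=
    le_of_forall_pos_le_add fun ε hε => by
      rw [zero_add]
      exact dist_ofMeasure_le_of_lipschitzDual_le hS P Q hε (h.trans_le (mul_self_nonneg ε))
  exact congrArg LevyProkhorov.toMeasure (eq_of_dist_eq_zero (le_antisymm h0 dist_nonneg))

/-- The metric on probability measures given by Kantorovich–Rubinstein duality. -/
abbrev lipschitzDualMetricSpace [LocallyCompactSpace S] [SecondCountableTopology S]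
    (hS : ∀ x y : S, dist x y ≤ 1) : MetricSpace (ProbabilityMeasure S) where
  dist P Q := lipschitzDual dist (P : Measure S) Q
  dist_self _ := lipschitzDual_self
  dist_comm _ _ := lipschitzDual_comm
  dist_triangle _ _ _ := lipschitzDual_triangle fun _ _ => dist_nonneg
  eq_of_dist_eq_zero h := eq_of_lipschitzDual_eq_zero hS h

/-- The distance given by Kantorovich–Rubinstein duality metrizes weak convergence. -/
theorem toTopologicalSpace_lipschitzDualMetricSpace [LocallyCompactSpace S]
    [SecondCountableTopology S] (hS : ∀ x y : S, dist x y ≤ 1) :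
    (lipschitzDualMetricSpace hS).toUniformSpace.toTopologicalSpace =
      ProbabilityMeasure.instTopologicalSpace := by
  -- Each distance controls the other uniformly: a dual distance at most ε² gives Lévy–Prokhorov
  -- distance at most ε, and the latter below δ/4 gives the former at most δ/2. The halvings provide
  -- the strict inequalities.
  have hu : @IsUniformInducing _ _ (lipschitzDualMetricSpace hS).toUniformSpace _
      (LevyProkhorov.ofMeasure : ProbabilityMeasure S → LevyProkhorov (ProbabilityMeasure S)) := by
    rw [@Metric.isUniformInducing_iff _ _ (lipschitzDualMetricSpace hS).toPseudoMetricSpace,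
      @Metric.uniformContinuous_iff _ _ (lipschitzDualMetricSpace hS).toPseudoMetricSpace]
    refine ⟨fun ε hε => ⟨ε / 2 * (ε / 2), by positivity, ?_⟩,
      fun δ hδ => ⟨δ / 4, by positivity, ?_⟩⟩
    · intro P Q h
      exact (dist_ofMeasure_le_of_lipschitzDual_le hS P Q (half_pos hε) (le_of_lt h)).trans_lt
        (half_lt_self hε)
    · intro P Q h
      exact lipschitzDual_lt_of_dist_ofMeasure_lt P Q hδ h
  have hi := @IsUniformInducing.isInducing _ _ (lipschitzDualMetricSpace hS).toUniformSpace _ _ hu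
  exact (@IsInducing.eq_induced _ _ (lipschitzDualMetricSpace hS).toUniformSpace.toTopologicalSpace
    _ _ hi).trans (LevyProkhorov.probabilityMeasureHomeomorph (Ω := S)).isInducing.eq_induced.symm

theorem tendsto_iff_tendsto_lipschitzDual [LocallyCompactSpace S]
    [SecondCountableTopology S] (hS : ∀ x y : S, dist x y ≤ 1) {ι : Type*} {l : Filter ι}
    {P : ι → ProbabilityMeasure S} {Q : ProbabilityMeasure S} :
    Tendsto P l (𝓝 Q) ↔
      Tendsto (fun i => lipschitzDual dist (P i : Measure S) Q) l (𝓝 0) := by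
  rw [← toTopologicalSpace_lipschitzDualMetricSpace hS]
  exact @tendsto_iff_dist_tendsto_zero _ _ (lipschitzDualMetricSpace hS).toPseudoMetricSpace _ _ _

end Metric

/-! ### Partial matchings and the triangle inequality -/

namespace PointMeasure

section Matching

variable {X : Type*} [MetricSpace X]

/-- Extends a partial matching to a permutation, so that permutations can be traded for pairs of
injections, which are symmetric in the two configurations and compose. -/
theorem exists_perm_comp_eq {ι α : Type*} [Finite α] {a b : ι → α} (ha : Function.Injective a)
    (hb : Function.Injective b) : ∃ π : Equiv.Perm α, ∀ i, π (a i) = b i := by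
  classical
  have := Fintype.ofFinite α
  let e : {x // x ∈ Set.range a} ≃ {x // x ∈ Set.range b} :=
    (Equiv.ofInjective a ha).symm.trans (Equiv.ofInjective b hb)
  refine ⟨e.extendSubtype, fun i => ?_⟩
  rw [Equiv.extendSubtype_apply_of_mem e (a i) ⟨i, rfl⟩]
  change ((Equiv.ofInjective b hb) ((Equiv.ofInjective a ha).symm ⟨a i, _⟩) : α) = b i
  rw [Equiv.ofInjective_symm_apply]
  rfl

theorem sum_comp_le_sum {ι κ : Type*} [Fintype ι] [Fintype κ] {a : ι → κ}
    (ha : Function.Injective a) {f : κ → ℝ} (hf : ∀ k, 0 ≤ f k) : ∑ i, f (a i) ≤ ∑ k, f k := by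
  classical
  exact (Finset.sum_map Finset.univ ⟨a, ha⟩ f).symm.trans_le (Finset.sum_le_univ_sum_of_nonneg hf)

theorem sum_le_sum_comp_add {ι κ : Type*} [Fintype ι] [Fintype κ] {a : ι → κ}
    (ha : Function.Injective a) {f : κ → ℝ} (hf : ∀ k, f k ≤ 1) :
    ∑ k, f k ≤ ∑ i, f (a i) + ((Fintype.card κ : ℝ) - Fintype.card ι) := by
  have := sum_comp_le_sum ha (f := fun k => 1 - f k) fun k => sub_nonneg.2 (hf k)
  simp only [Finset.sum_sub_distrib, Finset.sum_const, Finset.card_univ, nsmul_eq_mul,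
    mul_one] at this
  linarith

/-- Extend the matching to a permutation; each of the remaining points of x costs at most 1 since
distances are at most 1. -/
theorem matchCost_le_of_matching (hX : ∀ x y : X, dist x y ≤ 1) {m n : ℕ} (h : m ≤ n)
    (x : Fin m → X) (y : Fin n → X) {ι : Type*} [Fintype ι] {a : ι → Fin m} {b : ι → Fin n}
    (ha : Function.Injective a) (hb : Function.Injective b) :
    matchCost h x y ≤ ∑ i, dist (x (a i)) (y (b i)) + (m - Fintype.card ι) := by
  obtain ⟨π, hπ⟩ := exists_perm_comp_eq ((Fin.castLE_injective h).comp ha) hb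
  refine (Finset.inf'_le _ (Finset.mem_univ π)).trans ?_
  refine (sum_le_sum_comp_add ha fun k => hX _ _).trans (le_of_eq ?_)
  simp only [Function.comp_apply] at hπ
  simp only [hπ, Fintype.card_fin]

theorem exists_matchCost_eq {m n : ℕ} (h : m ≤ n) (x : Fin m → X) (y : Fin n → X) :
    ∃ b : Fin m → Fin n, Function.Injective b ∧ matchCost h x y = ∑ i, dist (x i) (y (b i)) := by
  obtain ⟨π, -, hπ⟩ := Finset.exists_mem_eq_inf' Finset.univ_nonempty
    fun π : Equiv.Perm (Fin n) => ∑ i : Fin m, dist (x i) (y (π (Fin.castLE h i)))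
  exact ⟨_, π.injective.comp (Fin.castLE_injective h), hπ⟩

theorem dbar1Points_le_of_matching (hX : ∀ x y : X, dist x y ≤ 1) {m n : ℕ}
    (x : Fin m → X) (y : Fin n → X) {ι : Type*} [Fintype ι] {a : ι → Fin m} {b : ι → Fin n}
    (ha : Function.Injective a) (hb : Function.Injective b) :
    dbar1Points x y ≤
      (∑ i, dist (x (a i)) (y (b i)) + (max (m : ℝ) n - Fintype.card ι)) / max (m : ℝ) n := by
  unfold dbar1Points
  split_ifs with h
  · rw [max_eq_right (Nat.cast_le.2 h)]
    have := matchCost_le_of_matching hX h x y ha hb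
    exact div_le_div_of_nonneg_right (by linarith) (Nat.cast_nonneg n)
  · have h' := le_of_not_ge h
    rw [max_eq_left (Nat.cast_le.2 h')]
    have := matchCost_le_of_matching hX h' y x hb ha
    simp only [dist_comm (x _)]
    exact div_le_div_of_nonneg_right (by linarith) (Nat.cast_nonneg m)

theorem exists_matching_dbar1Points_eq {m n : ℕ} (x : Fin m → X) (y : Fin n → X) :
    ∃ (a : Fin (min m n) → Fin m) (b : Fin (min m n) → Fin n), Function.Injective a ∧
      Function.Injective b ∧ dbar1Points x y =
        (∑ i, dist (x (a i)) (y (b i)) + (max (m : ℝ) n - min (m : ℝ) n)) / max (m : ℝ) n := by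
  unfold dbar1Points
  split_ifs with h
  · rw [max_eq_right (Nat.cast_le.2 h : (m : ℝ) ≤ n), min_eq_left (Nat.cast_le.2 h : (m : ℝ) ≤ n)]
    obtain ⟨b, hb, hc⟩ := exists_matchCost_eq h x y
    have e : min m n = m := min_eq_left h
    rw [hc]
    generalize min m n = k at *
    subst e
    exact ⟨id, b, Function.injective_id, hb, rfl⟩
  · have h' := le_of_not_ge h
    rw [max_eq_left (Nat.cast_le.2 h' : (n : ℝ) ≤ m), min_eq_right (Nat.cast_le.2 h' : (n : ℝ) ≤ m)]
    obtain ⟨a, ha, hc⟩ := exists_matchCost_eq h' y x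
    have e : min m n = n := min_eq_right h'
    rw [hc]
    simp only [dist_comm (y _)]
    generalize min m n = k at *
    subst e
    exact ⟨a, id, ha, Function.injective_id, rfl⟩

theorem dbar1Points_le_one (hX : ∀ x y : X, dist x y ≤ 1) {m n : ℕ} (x : Fin m → X)
    (y : Fin n → X) : dbar1Points x y ≤ 1 := by
  -- The empty matching already costs at most 1 after normalization.
  refine (dbar1Points_le_of_matching hX x y (a := Empty.elim) (b := Empty.elim)
    (Function.injective_of_subsingleton _) (Function.injective_of_subsingleton _)).trans ?_
  simpa using div_self_le_one (max (m : ℝ) n)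

theorem dbar1Points_comm (hX : ∀ x y : X, dist x y ≤ 1) {m n : ℕ} (x : Fin m → X)
    (y : Fin n → X) : dbar1Points x y = dbar1Points y x := by
  have key : ∀ {m n : ℕ} (x : Fin m → X) (y : Fin n → X), dbar1Points x y ≤ dbar1Points y x := by
    intro m n x y
    obtain ⟨a, b, ha, hb, h⟩ := exists_matching_dbar1Points_eq y x
    rw [h]
    refine (dbar1Points_le_of_matching hX x y hb ha).trans (le_of_eq ?_)
    simp only [dist_comm (x _), max_comm (m : ℝ), Fintype.card_fin, Nat.cast_min]
  exact (key x y).antisymm (key y x)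

theorem relDiff_eq (m n : ℕ) :
    relDiff m n = (max (m : ℝ) n - min (m : ℝ) n) / max (m : ℝ) n := by
  rw [relDiff, max_sub_min_eq_abs']

theorem relDiff_nonneg (m n : ℕ) : 0 ≤ relDiff m n := by
  unfold relDiff
  positivity

theorem relDiff_le_one (m n : ℕ) : relDiff m n ≤ 1 := by
  rw [relDiff_eq]
  refine div_le_one_of_le₀ ?_ (by positivity)
  have : (0 : ℝ) ≤ min (m : ℝ) n := by positivity
  linarith

/-- The worst case is n = m + 1. The bound depends on m alone, so a small `dbar1` ball contains only
measures with the same number of points as its centre. -/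
theorem inv_succ_le_relDiff {m n : ℕ} (h : m ≠ n) : ((m : ℝ) + 1)⁻¹ ≤ relDiff m n := by
  rw [inv_eq_one_div, relDiff]
  rcases lt_or_gt_of_ne h with h | h
  · have h' : (m : ℝ) + 1 ≤ n := by exact_mod_cast h
    have hm : (0 : ℝ) ≤ m := Nat.cast_nonneg m
    rw [abs_sub_comm, abs_of_nonneg (by linarith), max_eq_right (by linarith),
      div_le_div_iff₀ (by linarith) (by linarith)]
    nlinarith
  · have h' : (n : ℝ) + 1 ≤ m := by exact_mod_cast h
    have hn : (0 : ℝ) ≤ n := Nat.cast_nonneg n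
    rw [abs_of_nonneg (by linarith), max_eq_left (by linarith),
      div_le_div_iff₀ (by linarith) (by linarith)]
    nlinarith

theorem relDiff_le_dbar1Points {m n : ℕ} (x : Fin m → X) (y : Fin n → X) :
    relDiff m n ≤ dbar1Points x y := by
  obtain ⟨a, b, -, -, h⟩ := exists_matching_dbar1Points_eq x y
  rw [h, relDiff_eq]
  refine div_le_div_of_nonneg_right ?_ (by positivity)
  have : 0 ≤ ∑ i, dist (x (a i)) (y (b i)) := Finset.sum_nonneg fun _ _ => dist_nonneg
  linarith

theorem dbar1Points_le_d1Points (hX : ∀ x y : X, dist x y ≤ 1) {m n : ℕ} (x : Fin m → X)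
    (y : Fin n → X) : dbar1Points x y ≤ d1Points x y := by
  unfold d1Points
  split_ifs with h
  · subst h
    simp [dbar1Points]
  · exact dbar1Points_le_one hX x y

/-- Join the pairs that meet in the same point of y. By inclusion–exclusion among the l points of y,
at least |ι| + |κ| - l pairs survive. -/
theorem exists_comp_matching {k l m : ℕ} (x : Fin k → X) (y : Fin l → X) (z : Fin m → X)
    {ι κ : Type} [Fintype ι] [Fintype κ] {a : ι → Fin k} {b : ι → Fin l} {a' : κ → Fin l}
    {b' : κ → Fin m} (ha : Function.Injective a) (hb : Function.Injective b)
    (ha' : Function.Injective a') (hb' : Function.Injective b') :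
    ∃ (σ : Type) (_ : Fintype σ) (f : σ → Fin k) (g : σ → Fin m), Function.Injective f ∧
      Function.Injective g ∧ Fintype.card ι + Fintype.card κ ≤ Fintype.card σ + l ∧
      ∑ i, dist (x (f i)) (z (g i)) ≤
        ∑ i, dist (x (a i)) (y (b i)) + ∑ i, dist (y (a' i)) (z (b' i)) := by
  classical
  let σ := {p : ι × κ // b p.1 = a' p.2}
  have h1 : Function.Injective fun p : σ => p.1.1 := by
    rintro ⟨⟨i, j⟩, hp⟩ ⟨⟨i', j'⟩, hp'⟩ (rfl : i = i')
    obtain rfl : j = j' := ha' (hp.symm.trans hp')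
    rfl
  have h2 : Function.Injective fun p : σ => p.1.2 := by
    rintro ⟨⟨i, j⟩, hp⟩ ⟨⟨i', j'⟩, hp'⟩ (rfl : j = j')
    obtain rfl : i = i' := hb (hp.trans hp'.symm)
    rfl
  refine ⟨σ, inferInstance, fun p => a p.1.1, fun p => b' p.1.2, ha.comp h1, hb'.comp h2, ?_, ?_⟩
  · have hsub : Finset.univ.image b ∩ Finset.univ.image a' ⊆
        Finset.univ.image fun p : σ => b p.1.1 := by
      intro j hj
      obtain ⟨hj1, hj2⟩ := Finset.mem_inter.1 hj
      obtain ⟨i, -, hi⟩ := Finset.mem_image.1 hj1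
      obtain ⟨i', -, hi'⟩ := Finset.mem_image.1 hj2
      exact Finset.mem_image.2 ⟨⟨(i, i'), hi.trans hi'.symm⟩, Finset.mem_univ _, hi⟩
    have e1 := (Finset.card_le_card hsub).trans Finset.card_image_le
    have e2 := Finset.card_union_add_card_inter (Finset.univ.image b) (Finset.univ.image a')
    have e3 := Finset.card_le_univ (Finset.univ.image b ∪ Finset.univ.image a')
    rw [Finset.card_image_of_injective _ hb, Finset.card_image_of_injective _ ha'] at e2
    simp only [Finset.card_univ, Fintype.card_fin] at e1 e2 e3
    omega
  · calc ∑ p : σ, dist (x (a p.1.1)) (z (b' p.1.2))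
        ≤ ∑ p : σ, (dist (x (a p.1.1)) (y (b p.1.1)) + dist (y (a' p.1.2)) (z (b' p.1.2))) := by
          refine Finset.sum_le_sum fun p _ => ?_
          rw [← p.2]
          exact dist_triangle _ _ _
      _ ≤ _ := by
          rw [Finset.sum_add_distrib]
          exact add_le_add
            (sum_comp_le_sum h1 (f := fun i => dist (x (a i)) (y (b i))) fun _ => dist_nonneg)
            (sum_comp_le_sum h2 (f := fun i => dist (y (a' i)) (z (b' i))) fun _ => dist_nonneg)

/-- Compose optimal matchings and put K = max k m. If l ≤ K, both denominators on the right may be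
enlarged to K, and the numerators compare by K + l ≤ max k l + max l m. If l > K, both denominators
equal l, and with D the left side one bounds l D = K D + (l - K) D, using D ≤ 1 in the last term. -/
theorem dbar1Points_triangle (hX : ∀ x y : X, dist x y ≤ 1) {k l m : ℕ} (x : Fin k → X)
    (y : Fin l → X) (z : Fin m → X) :
    dbar1Points x z ≤ dbar1Points x y + dbar1Points y z := by
  obtain ⟨a, b, ha, hb, h1⟩ := exists_matching_dbar1Points_eq x y
  obtain ⟨a', b', ha', hb', h2⟩ := exists_matching_dbar1Points_eq y z
  obtain ⟨σ, _, f, g, hf, hg, hcard, hsum⟩ := exists_comp_matching x y z ha hb ha' hb'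
  have hD := dbar1Points_le_of_matching hX x z hf hg
  have hD1 := dbar1Points_le_one hX x z
  rw [h1, h2]
  have hS1 : ∑ i, dist (x (a i)) (y (b i)) ≤ min (k : ℝ) l := by
    refine (Finset.sum_le_card_nsmul _ _ 1 fun i _ => hX _ _).trans ?_
    simp
  have hS2 : ∑ i, dist (y (a' i)) (z (b' i)) ≤ min (l : ℝ) m := by
    refine (Finset.sum_le_card_nsmul _ _ 1 fun i _ => hX _ _).trans ?_
    simp
  have hS1' : 0 ≤ ∑ i, dist (x (a i)) (y (b i)) := Finset.sum_nonneg fun _ _ => dist_nonneg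
  have hS2' : 0 ≤ ∑ i, dist (y (a' i)) (z (b' i)) := Finset.sum_nonneg fun _ _ => dist_nonneg
  have hcard' : min (k : ℝ) l + min (l : ℝ) m ≤ Fintype.card σ + l := by
    rw [Fintype.card_fin, Fintype.card_fin] at hcard
    exact_mod_cast hcard
  have hS' : 0 ≤ ∑ i, dist (x (f i)) (z (g i)) := Finset.sum_nonneg fun _ _ => dist_nonneg
  have hck : (Fintype.card σ : ℝ) ≤ k := by
    have := Fintype.card_le_of_injective f hf
    rw [Fintype.card_fin] at this
    exact_mod_cast this
  set S := ∑ i, dist (x (f i)) (z (g i))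
  set S1 := ∑ i, dist (x (a i)) (y (b i))
  set S2 := ∑ i, dist (y (a' i)) (z (b' i))
  set D := dbar1Points x z
  set c : ℝ := (Fintype.card σ : ℝ)
  clear_value S S1 S2 D c
  clear h1 h2 hcard
  have hk : (0 : ℝ) ≤ k := Nat.cast_nonneg k
  have hl : (0 : ℝ) ≤ l := Nat.cast_nonneg l
  have hm : (0 : ℝ) ≤ m := Nat.cast_nonneg m
  generalize (k : ℝ) = k at *
  generalize (l : ℝ) = l at *
  generalize (m : ℝ) = m at *
  have e1 := min_add_max k l
  have e2 := min_add_max l m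
  have hkl := min_le_max (a := k) (b := l)
  have hlm := min_le_max (a := l) (b := m)
  rcases le_or_gt l (max k m) with h | h
  · have hA : max k l ≤ max k m := max_le (le_max_left _ _) h
    have hB : max l m ≤ max k m := max_le h (le_max_right _ _)
    have hsum' : max k m + l ≤ max k l + max l m := by
      rcases max_cases k m with ⟨h, -⟩ | ⟨h, -⟩ <;> rw [h]
      · linarith [le_max_left k l, le_max_left l m]
      · linarith [le_max_right k l, le_max_right l m]
    -- The condition N ≤ A excludes a positive N over A = 0, a quotient that would be read as 0.
    have hdiv : ∀ {N A K : ℝ}, 0 ≤ N → N ≤ A → A ≤ K → N / K ≤ N / A := by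
      intro N A K hN hNA hAK
      rcases hN.eq_or_lt with rfl | hN
      · simp
      · exact div_le_div_of_nonneg_left hN.le (hN.trans_le hNA) hAK
    have g1 := hdiv (N := S1 + (max k l - min k l)) (by linarith) (by linarith) hA
    have g2 := hdiv (N := S2 + (max l m - min l m)) (by linarith) (by linarith) hB
    refine hD.trans (le_trans ?_ (add_le_add g1 g2))
    rw [← add_div]
    exact div_le_div_of_nonneg_right (by linarith) (hk.trans (le_max_left _ _))
  · have hkl' : k ≤ l := (le_max_left k m).trans h.le
    have hml' : m ≤ l := (le_max_right k m).trans h.le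
    have hK : 0 ≤ max k m := hk.trans (le_max_left _ _)
    have hDK : D * max k m ≤ S + (max k m - c) := by
      rcases hK.eq_or_lt with h0 | h0
      · rw [← h0, mul_zero]
        linarith [le_max_left k m]
      · exact (le_div_iff₀ h0).1 hD
    rw [max_eq_right hkl', max_eq_left hml', min_eq_left hkl', min_eq_right hml', ← add_div,
      le_div_iff₀ (hK.trans_lt h)]
    rw [min_eq_left hkl', min_eq_right hml'] at hcard'
    nlinarith [mul_le_mul_of_nonneg_right hD1 (sub_nonneg.2 h.le)]

end Matching
end PointMeasure

/-! ### The vague topology and `dbar1` -/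

namespace PointMeasure

section Space

theorem ofPoints_points {X : Type*} [MeasurableSpace X] (ξ : PointMeasure X) : ofPoints ξ.points = ξ :=
  Subtype.ext (Subtype.ext ξ.toMeasure_eq_sum.symm)

theorem dbar1_nonneg {X : Type*} [MetricSpace X] [MeasurableSpace X] (ξ η : PointMeasure X) : 0 ≤ dbar1 ξ η :=
  (relDiff_nonneg _ _).trans (relDiff_le_dbar1Points _ _)

theorem continuous_matchCost {X : Type*} [MetricSpace X] {m n : ℕ} (h : m ≤ n) :
    Continuous fun p : (Fin m → X) × (Fin n → X) => matchCost h p.1 p.2 := by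
  unfold matchCost
  exact Continuous.finset_inf'_apply _ fun π _ => by fun_prop

theorem continuous_dbar1Points {X : Type*} [MetricSpace X] {m n : ℕ} :
    Continuous fun p : (Fin m → X) × (Fin n → X) => dbar1Points p.1 p.2 := by
  unfold dbar1Points
  split_ifs with h
  · exact ((continuous_matchCost h).add continuous_const).div_const _
  · exact (((continuous_matchCost (le_of_not_ge h)).comp continuous_swap).add
      continuous_const).div_const _

variable {X : Type*} [MetricSpace X] [MeasurableSpace X]

theorem ofPoints_eq_of_dbar1Points_eq_zero {m n : ℕ} {x : Fin m → X} {y : Fin n → X}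
    (h : dbar1Points x y = 0) : ofPoints x = ofPoints y := by
  obtain ⟨a, b, ha, hb, hd⟩ := exists_matching_dbar1Points_eq x y
  rw [h] at hd
  have hS : 0 ≤ ∑ i, dist (x (a i)) (y (b i)) := Finset.sum_nonneg fun _ _ => dist_nonneg
  have hmM := min_le_max (a := (m : ℝ)) (b := n)
  have hmn : m = n := by
    by_contra hne
    have := inv_succ_le_relDiff hne
    have h2 := (relDiff_le_dbar1Points x y).trans_eq h
    have : (0 : ℝ) < ((m : ℝ) + 1)⁻¹ := by positivity
    linarith
  subst hmn
  have hS0 : ∀ i, x (a i) = y (b i) := by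
    intro i
    have hm : 0 < max (m : ℝ) m := by
      rw [max_self]
      exact_mod_cast (a i).pos
    have h0 := (div_eq_zero_iff.1 hd.symm).resolve_right hm.ne'
    rw [max_self (m : ℝ), min_self (m : ℝ), sub_self, add_zero] at h0
    exact dist_eq_zero.1
      ((Finset.sum_eq_zero_iff_of_nonneg fun _ _ => dist_nonneg).1 h0 i (Finset.mem_univ i))
  have hbij : ∀ {f : Fin (min m m) → Fin m}, Function.Injective f → Function.Bijective f :=
    fun hf => (Fintype.bijective_iff_injective_and_card _).2 ⟨hf, by simp⟩
  refine Subtype.ext (Subtype.ext ?_)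
  change ∑ i, Measure.dirac (x i) = ∑ i, Measure.dirac (y i)
  rw [← (hbij ha).sum_comp, ← (hbij hb).sum_comp]
  simp only [hS0]

theorem dbar1_self (ξ : PointMeasure X) : dbar1 ξ ξ = 0 := by
  refine le_antisymm ?_ (dbar1_nonneg ξ ξ)
  unfold dbar1 dbar1Points
  rw [dif_pos le_rfl, sub_self, add_zero]
  refine div_nonpos_of_nonpos_of_nonneg ?_ (Nat.cast_nonneg _)
  refine (Finset.inf'_le _ (Finset.mem_univ 1)).trans (le_of_eq ?_)
  simp

theorem eq_of_dbar1_eq_zero {ξ η : PointMeasure X} (h : dbar1 ξ η = 0) : ξ = η := by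
  rw [← ofPoints_points ξ, ← ofPoints_points η]
  exact ofPoints_eq_of_dbar1Points_eq_zero h

variable [BorelSpace X]

instance : T2Space (PointMeasure X) :=
  inferInstanceAs (T2Space {ξ : FiniteMeasure X // ∃ (n : ℕ) (x : Fin n → X),
    (ξ : Measure X) = ∑ i, Measure.dirac (x i)})

/-- The number of points is the total mass, which is vaguely continuous, and ℕ is embedded in ℝ with
its discrete topology. -/
theorem continuous_card : Continuous (card : PointMeasure X → ℕ) := by
  refine Nat.isClosedEmbedding_coe_real.isInducing.continuous_iff.2 ?_
  have h : Continuous fun ξ : PointMeasure X => ((ξ.1.mass : NNReal) : ℝ) :=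
    NNReal.continuous_coe.comp (FiniteMeasure.continuous_mass.comp continuous_subtype_val)
  refine h.congr fun ξ => ?_
  have := ξ.toMeasure_univ
  rw [Function.comp_apply, ← ENNReal.toReal_natCast, ← this]
  rfl

theorem continuous_ofPoints (n : ℕ) :
    Continuous (ofPoints : (Fin n → X) → PointMeasure X) := by
  refine Continuous.subtype_mk (continuous_iff_continuousAt.2 fun x => ?_) _
  refine FiniteMeasure.tendsto_iff_forall_integral_tendsto.2 fun f => ?_
  have h : ∀ x : Fin n → X, ∫ z, f z ∂(∑ i, Measure.dirac (x i)) = ∑ i, f (x i) := fun x => by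
    rw [integral_finsetSum_measure fun i _ => f.integrable _]
    simp [integral_dirac' _ _ f.continuous.stronglyMeasurable]
  change Tendsto (fun y : Fin n → X => ∫ z, f z ∂(∑ i, Measure.dirac (y i))) (𝓝 x)
    (𝓝 (∫ z, f z ∂(∑ i, Measure.dirac (x i))))
  simp only [h]
  exact (continuous_finsetSum _ fun i _ => f.continuous.comp (continuous_apply i)).continuousAt

theorem range_ofPoints (n : ℕ) :
    Set.range (ofPoints : (Fin n → X) → PointMeasure X) = {ξ | ξ.card = n} := by
  ext ξ
  constructor
  · rintro ⟨x, rfl⟩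
    exact card_ofPoints x
  · rintro rfl
    exact ⟨ξ.points, ofPoints_points ξ⟩

theorem isCompact_card_eq [CompactSpace X] (n : ℕ) :
    IsCompact {ξ : PointMeasure X | ξ.card = n} := by
  rw [← range_ofPoints]
  exact isCompact_range (continuous_ofPoints n)

theorem isOpen_card_eq (n : ℕ) : IsOpen {ξ : PointMeasure X | ξ.card = n} :=
  (isOpen_discrete {n}).preimage continuous_card

instance [CompactSpace X] : LocallyCompactSpace (PointMeasure X) := by
  have : WeaklyLocallyCompactSpace (PointMeasure X) :=
    ⟨fun ξ => ⟨_, isCompact_card_eq ξ.card, (isOpen_card_eq _).mem_nhds rfl⟩⟩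
  infer_instance

instance [CompactSpace X] : SigmaCompactSpace (PointMeasure X) :=
  ⟨⟨fun n => {ξ | ξ.card = n}, isCompact_card_eq, Set.eq_univ_of_forall fun ξ =>
    Set.mem_iUnion.2 ⟨ξ.card, rfl⟩⟩⟩

/-- On each open block of fixed numbers of points, the enumeration map from the compact product of
powers of X is closed and onto, so continuity descends from `dbar1Points`. -/
theorem continuous_dbar1 [CompactSpace X] :
    Continuous fun p : PointMeasure X × PointMeasure X => dbar1 p.1 p.2 := by
  refine continuous_iff_continuousAt.2 fun p => ?_
  have hU := (isOpen_card_eq (X := X) p.1.card).prod (isOpen_card_eq (X := X) p.2.card)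
  refine ContinuousOn.continuousAt ?_ (hU.mem_nhds ⟨rfl, rfl⟩)
  refine continuousOn_iff_isClosed.2 fun t ht => ?_
  let F : (Fin p.1.card → X) × (Fin p.2.card → X) → PointMeasure X × PointMeasure X :=
    Prod.map ofPoints ofPoints
  have hF : Continuous F := (continuous_ofPoints _).prodMap (continuous_ofPoints _)
  refine ⟨F '' ((fun q => dbar1Points q.1 q.2) ⁻¹' t),
    ((ht.preimage continuous_dbar1Points).isCompact.image hF).isClosed, ?_⟩
  ext q
  constructor
  · rintro ⟨hq, hmem⟩
    obtain ⟨x, hx⟩ := (range_ofPoints p.1.card).superset hmem.1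
    obtain ⟨y, hy⟩ := (range_ofPoints p.2.card).superset hmem.2
    refine ⟨⟨(x, y), ?_, Prod.ext hx hy⟩, hmem⟩
    change dbar1Points x y ∈ t
    rw [← dbar1_ofPoints, hx, hy]
    exact hq
  · rintro ⟨⟨⟨x, y⟩, hxy, rfl⟩, hq⟩
    refine ⟨?_, hq⟩
    change dbar1 (ofPoints x) (ofPoints y) ∈ t
    rw [dbar1_ofPoints]
    exact hxy

theorem isOpen_iff_dbar1 [CompactSpace X] (s : Set (PointMeasure X)) :
    IsOpen s ↔ ∀ ξ ∈ s, ∃ ε > 0, ∀ η, dbar1 ξ η < ε → η ∈ s := by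
  have hcont : ∀ ξ : PointMeasure X, Continuous fun η => dbar1 ξ η := fun ξ =>
    continuous_dbar1.comp (Continuous.prodMk_right ξ)
  constructor
  · intro hs ξ hξ
    -- The measures outside s with as many points as ξ form a compact set, so their distance to ξ is
    -- attained and positive.
    obtain ⟨δ, hδ, hδs⟩ : ∃ δ > 0, ∀ η, η.card = ξ.card → η ∉ s → δ ≤ dbar1 ξ η := by
      rcases ({η | η.card = ξ.card} \ s).eq_empty_or_nonempty with he | hne
      · exact ⟨1, one_pos, fun η h1 h2 => absurd (he.subset ⟨h1, h2⟩) (Set.notMem_empty _)⟩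
      · obtain ⟨η₀, hη₀, hmin⟩ := ((isCompact_card_eq ξ.card).diff hs).exists_isMinOn hne
          (hcont ξ).continuousOn
        refine ⟨dbar1 ξ η₀, (dbar1_nonneg _ _).lt_of_ne fun h => hη₀.2 ?_,
          fun η h1 h2 => hmin ⟨h1, h2⟩⟩
        rwa [← eq_of_dbar1_eq_zero h.symm]
    refine ⟨min δ ((ξ.card : ℝ) + 1)⁻¹, lt_min hδ (by positivity), fun η hη => ?_⟩
    by_contra hηs
    obtain ⟨h1, h2⟩ := lt_min_iff.1 hη
    have hcard : η.card = ξ.card := by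
      by_contra hne
      exact absurd ((inv_succ_le_relDiff (Ne.symm hne)).trans (relDiff_le_dbar1Points _ _))
        (not_le.2 h2)
    exact absurd (hδs η hcard hηs) (not_le.2 h1)
  · intro h
    refine isOpen_iff_mem_nhds.2 fun ξ hξ => ?_
    obtain ⟨ε, hε, hs⟩ := h ξ hξ
    refine mem_of_superset ((hcont ξ).continuousAt.preimage_mem_nhds (Iio_mem_nhds ?_)) hs
    rwa [dbar1_self]

/-- The metric space structure given by `d̄₁`; its topology is the vague topology. -/
abbrev dbar1MetricSpace [CompactSpace X] (hX : ∀ x y : X, dist x y ≤ 1) :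
    MetricSpace (PointMeasure X) :=
  -- This construction keeps the vague topology as the underlying one, so the existing Borel
  -- structure and weak topology still apply.
  { PseudoMetricSpace.ofDistTopology dbar1 dbar1_self
      (fun ξ η => dbar1Points_comm hX ξ.points η.points)
      (fun ξ η ζ => dbar1Points_triangle hX ξ.points η.points ζ.points) isOpen_iff_dbar1 with
    eq_of_dist_eq_zero := eq_of_dbar1_eq_zero }

theorem secondCountableTopology [CompactSpace X] (hX : ∀ x y : X, dist x y ≤ 1) :
    SecondCountableTopology (PointMeasure X) := by
  let := dbar1MetricSpace hX
  exact EMetric.secondCountable_of_sigmaCompact _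

end Space

end PointMeasure

/-! ### Passage to the number of points -/

namespace PointMeasure

/-- The pair of cardinalities under an optimal coupling is a coupling of their laws, and `relDiff`
of the cardinalities is at most `dbar1`. -/
theorem dRW_map_card_le_dbar2 {X : Type*} [MetricSpace X] [CompactSpace X] [MeasurableSpace X]
    [BorelSpace X] (hX : ∀ x y : X, dist x y ≤ 1) (P Q : Measure (PointMeasure X))
    (h : IsLeast (couplingCosts dbar1 P Q) (dbar2 P Q)) [IsProbabilityMeasure P] :
    dRW (P.map card) (Q.map card) ≤ dbar2 P Q := by
  have := secondCountableTopology hX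
  obtain ⟨γ, h1, h2, hγ⟩ := h.1
  have hprob := isProbabilityMeasure_of_map_fst P h1
  have hm := (continuous_card (X := X)).measurable
  have hmm : Measurable (Prod.map card card : PointMeasure X × PointMeasure X → ℕ × ℕ) :=
    hm.prodMap hm
  have hmem : ∫ z, relDiff z.1 z.2 ∂(γ.map (Prod.map card card)) ∈
      couplingCosts relDiff (P.map card) (Q.map card) := by
    refine ⟨_, ?_, ?_, rfl⟩
    · rw [← h1, Measure.map_map measurable_fst hmm, Measure.map_map hm measurable_fst]
      rfl
    · rw [← h2, Measure.map_map measurable_snd hmm, Measure.map_map hm measurable_snd]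
      rfl
  refine (csInf_le ⟨0, ?_⟩ hmem).trans ?_
  · rintro _ ⟨γ', -, -, rfl⟩
    exact integral_nonneg fun z => relDiff_nonneg _ _
  · rw [hγ, integral_map hmm.aemeasurable
      (measurable_of_countable fun z : ℕ × ℕ => relDiff z.1 z.2).aestronglyMeasurable]
    refine integral_mono_of_nonneg (Eventually.of_forall fun z => relDiff_nonneg _ _) ?_
      (Eventually.of_forall fun z => relDiff_le_dbar1Points _ _)
    refine Integrable.of_bound continuous_dbar1.aestronglyMeasurable 1
      (Eventually.of_forall fun z => ?_)
    rw [Real.norm_of_nonneg (dbar1_nonneg _ _)]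
    exact dbar1Points_le_one hX _ _

end PointMeasure

end

/-! ### The proposition -/

theorem proposition2p3 {X : Type*} [MetricSpace X] [CompactSpace X] [MeasurableSpace X]
    [BorelSpace X] (hX : ∀ x y : X, dist x y ≤ 1) :
    -- (i) duality, with an attained minimum
    (∀ P Q : ProbabilityMeasure (PointMeasure X),
      IsLeast (couplingCosts PointMeasure.dbar1 (P : Measure (PointMeasure X)) Q)
        (PointMeasure.dbar2 (P : Measure (PointMeasure X)) Q)) ∧
    -- (ii) comparison with the other metrics; the minimum that defines `dRW` is attained
    (∀ μ ν : ProbabilityMeasure ℕ,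
      IsLeast (couplingCosts relDiff (μ : Measure ℕ) ν) (dRW (μ : Measure ℕ) ν)) ∧
    (∀ (Ω Ω' : Type*) [MeasurableSpace Ω] [MeasurableSpace Ω'] (ℙ : Measure Ω) (ℙ' : Measure Ω')
      [IsProbabilityMeasure ℙ] [IsProbabilityMeasure ℙ']
      (Ξ : Ω → PointMeasure X) (H : Ω' → PointMeasure X), Measurable Ξ → Measurable H →
      dRW (ℙ.map fun ω => (Ξ ω).card) (ℙ'.map fun ω => (H ω).card) ≤
          PointMeasure.dbar2 (ℙ.map Ξ) (ℙ'.map H) ∧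
        PointMeasure.dbar2 (ℙ.map Ξ) (ℙ'.map H) ≤ PointMeasure.d2 (ℙ.map Ξ) (ℙ'.map H)) ∧
    -- (iii) `dbar2` is a metric that induces the weak topology
    (∃ M : MetricSpace (ProbabilityMeasure (PointMeasure X)),
      (∀ P Q : ProbabilityMeasure (PointMeasure X),
        M.dist P Q = PointMeasure.dbar2 (P : Measure (PointMeasure X)) Q) ∧
      M.toUniformSpace.toTopologicalSpace =
        ProbabilityMeasure.instTopologicalSpace) ∧
    (∀ (Ω : ℕ → Type*) (Ω' : Type*) [∀ n, MeasurableSpace (Ω n)] [MeasurableSpace Ω']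
      (ℙ : ∀ n, Measure (Ω n)) (ℙ' : Measure Ω')
      [∀ n, IsProbabilityMeasure (ℙ n)] [IsProbabilityMeasure ℙ']
      (Ξ : ∀ n, Ω n → PointMeasure X) (Ξ' : Ω' → PointMeasure X),
      (∀ n, Measurable (Ξ n)) → Measurable Ξ' →
      (TendstoInDistribution Ξ atTop Ξ' ℙ ℙ' ↔
        Tendsto (fun n => PointMeasure.dbar2 ((ℙ n).map (Ξ n)) (ℙ'.map Ξ')) atTop (𝓝 0))) := by
  -- With this instance `lipschitzDual dist` is `dbar2` by definition, so the general results apply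
  -- as they stand.
  let _ : MetricSpace (PointMeasure X) := PointMeasure.dbar1MetricSpace hX
  have _ : SecondCountableTopology (PointMeasure X) := PointMeasure.secondCountableTopology hX
  have hS : ∀ ξ η : PointMeasure X, dist ξ η ≤ 1 := fun ξ η =>
    PointMeasure.dbar1Points_le_one hX ξ.points η.points
  have hdual : ∀ (P Q : Measure (PointMeasure X)) [IsProbabilityMeasure P]
      [IsProbabilityMeasure Q], IsLeast (couplingCosts PointMeasure.dbar1 P Q)
        (PointMeasure.dbar2 P Q) := fun P Q _ _ => isLeast_couplingCosts_lipschitzDual hS P Q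
  refine ⟨fun P Q => hdual P Q, fun μ ν => ?_, ?_, ?_, ?_⟩
  · refine isLeast_sInf_couplingCosts relDiff continuous_of_discreteTopology
      (fun m n => ?_) (μ : Measure ℕ) ν (C := 1)
    rw [abs_of_nonneg (PointMeasure.relDiff_nonneg m n)]
    exact PointMeasure.relDiff_le_one m n
  · intro Ω Ω' _ _ ℙ ℙ' _ _ Ξ H hΞ hH
    have := Measure.isProbabilityMeasure_map (μ := ℙ) hΞ.aemeasurable
    have := Measure.isProbabilityMeasure_map (μ := ℙ') hH.aemeasurable
    have hm := (PointMeasure.continuous_card (X := X)).measurable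
    -- Since `dbar1` ≤ `d1`, the supremum defining `d2` runs over a larger class of functions.
    refine ⟨?_, lipschitzDual_mono PointMeasure.dbar1_nonneg
      fun ξ η => PointMeasure.dbar1Points_le_d1Points hX ξ.points η.points⟩
    have := PointMeasure.dRW_map_card_le_dbar2 hX _ _ (hdual (ℙ.map Ξ) (ℙ'.map H))
    rwa [Measure.map_map hm hΞ, Measure.map_map hm hH] at this
  · exact ⟨lipschitzDualMetricSpace hS, fun P Q => rfl,
      toTopologicalSpace_lipschitzDualMetricSpace hS⟩
  · intro Ω Ω' _ _ ℙ ℙ' _ _ Ξ Ξ' hΞ hΞ'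
    have key := tendsto_iff_tendsto_lipschitzDual hS (l := atTop)
      (P := fun n => ⟨(ℙ n).map (Ξ n), Measure.isProbabilityMeasure_map (hΞ n).aemeasurable⟩)
      (Q := ⟨ℙ'.map Ξ', Measure.isProbabilityMeasure_map hΞ'.aemeasurable⟩)
    exact ⟨fun h => key.1 h.tendsto,
      fun h => ⟨fun n => (hΞ n).aemeasurable, hΞ'.aemeasurable, key.2 h⟩⟩
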